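/- **Setting.** Let $n\ge 0$, $N=2^n$, and let $U_1,\dots,U_M$ be $n$-qubit quantum circuits, i.e. sequences of layers of single-qubit and two-qubit unitary gates acting on disjoint qubits within a layer; the depth is the number of layers, and every $U_j$ has depth at most $d$. Let $|a_j\rangle=U_j|0^n\rangle\in\mathbb C^N$, let norms $\|a_j\|\ge 0$ be given classically, and let $A=\sum_{j=1}^M\|a_j\|\,|a_j\rangle\langle j|\in\mathbb C^{N\times M}$, $A\neq 0$. Let $0\neq c\in\mathbb C^M$ be given classically, $\varepsilon>0$ and $0<\delta<1$. Vector norms are Euclidean and matrix norms spectral; $X^{-1}$ is the Moore–Penrose pseudo-inverse of $X$ (the usual inverse if $X$ is invertible), and $\kappa=\|A\|\|A^{-1}\|$ is the ratio of the largest to the smallest nonzero singular value of $A$. Put $V=A^\dagger A$, $\alpha^*=V^{-1}c$, $\Gamma_2=\max_j\|a_j\|^2$, $$\lambda=\frac{\varepsilon}{2\|A^{-1}\|^8\|A\|^4\|c\|},\qquad F=\frac{\kappa^{12}\|A^{-1}\|^4\|c\|^2\bigl(\|A\|^2\|\alpha^*\|+\varepsilon+\|c\|\bigr)^2}{\varepsilon^4},\qquad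 T=C\,M F+\frac{M}{\|A\|^4},$$ where $C$ is a constant. **Algorithm 2** (the values $\lambda$ and $S$ being supplied). For all $j,k\in[M]$ run, independently, $S=\lceil\Gamma_2^2\,T\log(2/\delta)\rceil$ times each the Hadamard tests for the real part and for the imaginary part of $\langle 0|U_j^\dagger U_k|0\rangle=\langle a_j|a_k\rangle$; in each run the control qubit is measured, and the outcome $0$ has probability $(1+\mathrm{Re}\langle a_j|a_k\rangle)/2$, respectively $(1+\mathrm{Im}\langle a_j|a_k\rangle)/2$. If $Z_{jk}$ and $Z'_{jk}$ are the numbers of outcomes $0$, put $\hat v_{jk}=(2Z_{jk}/S-1)+i\,(2Z'_{jk}/S-1)$ and $\hat V_{jk}=\|a_j\|\|a_k\|\hat v_{jk}$. Set $\hat Q=\hat V^2+\lambda I$, compute classically $\hat\alpha=\hat Q^{-1}\hat V c$, the solution of the shifted system $(\hat V^2+\lambda I)\alpha=\hat Vc$, and output $s=(\hat\alpha_1\|a_1\|,\dots,\hat\alpha_M\|a_M\|)$. **Running time.** A run of a Hadamard test costs the depth of its circuit (over single-qubit and two-qubit gates, on $n+1$ qubits) plus one; the classical part is a straight-line program, depending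 on $M$ only, in which each complex arithmetic operation costs one. **Theorem.** There are universal constants $C,K>0$ such that, for all data as above, Algorithm 2 can be implemented (by exact circuits for its Hadamard tests and a straight-line program for its classical part) so that: 1. with probability at least $1-\delta$, $\hat Q$ is invertible and $\hat y=\sum_{j=1}^M s_j|a_j\rangle$ satisfies $$\|A^\dagger\hat y-c\|-\min_{y\in\mathbb C^N}\|A^\dagger y-c\|\le\varepsilon;$$ 2. with $$R=\frac{\Gamma_2^2M^3\kappa^{12}\|A^{-1}\|^4\|c\|^2\bigl(\|A\|^2\|\alpha^*\|+\varepsilon+\|c\|\bigr)^2}{\varepsilon^4}+\frac{\Gamma_2^2M^3}{\|A\|^4},$$ the running time is at most $K\bigl((n+1)(d+1)\,(R\log(2/\delta)+M^2)+M^3\bigr)$; 3. if moreover the columns of $A$ are linearly independent and $\varepsilon\le\|c\|$, the running time is at most $K\,(n+1)(d+1)\,R\,\log(2/\delta)$. In particular, when $d$ is polylogarithmic in $N$, the running time is $\tilde O(R+M^3)$, and in the case of item 3 it is $\tilde O(R)$. -/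

import Mathlib

noncomputable section

namespace SkewedLS

/-! ### Norms, pseudo-inverse, condition number -/

/-- The Euclidean norm of a complex vector. -/
def l2norm {ι : Type} [Fintype ι] (v : ι → ℂ) : ℝ :=
  ‖(WithLp.toLp 2 v : EuclideanSpace ℂ ι)‖

/-- The spectral norm of a complex matrix (its largest singular value): the operator norm
with respect to Euclidean norms. -/
def specNorm {m n : Type} [Fintype m] [Fintype n] [DecidableEq n] (A : Matrix m n ℂ) : ℝ :=
  ‖LinearMap.toContinuousLinearMap (Matrix.toEuclideanLin A)‖

/-- The Moore-Penrose pseudo-inverse `A⁺ = W diag(σᵢ²)⁺ W† A†`, where `A† A = W diag(σᵢ²) W†`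
is an eigendecomposition and `⁺` on the diagonal replaces every nonzero entry by its reciprocal
(in Lean `0⁻¹ = 0`). -/
def pinv {m n : Type} [Fintype m] [Fintype n] [DecidableEq n] (A : Matrix m n ℂ) :
    Matrix n m ℂ :=
  let h := Matrix.isHermitian_conjTranspose_mul_self A
  (h.eigenvectorUnitary : Matrix n n ℂ)
    * Matrix.diagonal (fun i => (((h.eigenvalues i)⁻¹ : ℝ) : ℂ))
    * (h.eigenvectorUnitary : Matrix n n ℂ).conjTranspose * A.conjTranspose

/-- The condition number `κ(A) = ‖A‖ ‖A⁺‖`, the ratio of the largest to the smallest nonzero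
singular value. -/
def cond {m n : Type} [Fintype m] [Fintype n] [DecidableEq m] [DecidableEq n]
    (A : Matrix m n ℂ) : ℝ :=
  specNorm A * specNorm (pinv A)

/-! ### Quantum circuits made of single-qubit and two-qubit gates -/

/-- A gate: an arbitrary unitary on one or two of the qubits in `Q`. -/
structure Gate (Q : Type) [DecidableEq Q] where
  qubits : Finset Q
  nonempty : qubits.Nonempty
  card_le : qubits.card ≤ 2
  mat : Matrix (qubits → Bool) (qubits → Bool) ℂ
  unitary : mat ∈ Matrix.unitaryGroup (qubits → Bool) ℂ

/-- The action of a gate on all qubits: its own unitary on its qubits, tensored with the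
identity on the others.  The computational basis is `Q → Bool`. -/
def Gate.toMatrix {Q : Type} [Fintype Q] [DecidableEq Q] (g : Gate Q) :
    Matrix (Q → Bool) (Q → Bool) ℂ := fun x y =>
  if ∀ i, i ∉ g.qubits → x i = y i then g.mat (fun i => x i) (fun i => y i) else 0

/-- One layer of a circuit: gates acting on pairwise disjoint sets of qubits. -/
structure Layer (Q : Type) [DecidableEq Q] where
  gates : List (Gate Q)
  disjoint : gates.Pairwise (fun g h => Disjoint g.qubits h.qubits)

/-- The unitary of a layer (its gates commute, so the order is irrelevant). -/
def Layer.toMatrix {Q : Type} [Fintype Q] [DecidableEq Q] (L : Layer Q) :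
    Matrix (Q → Bool) (Q → Bool) ℂ :=
  (L.gates.map Gate.toMatrix).prod

/-- A circuit is a sequence of layers, the head of the list being executed first. -/
structure Circuit (Q : Type) [DecidableEq Q] where
  layers : List (Layer Q)

/-- The depth of a circuit: its number of layers. -/
def Circuit.depth {Q : Type} [DecidableEq Q] (C : Circuit Q) : ℕ := C.layers.length

/-- The unitary implemented by a circuit. -/
def Circuit.toMatrix {Q : Type} [Fintype Q] [DecidableEq Q] (C : Circuit Q) :
    Matrix (Q → Bool) (Q → Bool) ℂ :=
  C.layers.foldl (fun acc L => L.toMatrix * acc) 1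

/-- The basis state in which every qubit is `0`. -/
def zeroState (Q : Type) : Q → Bool := fun _ => false

/-- The state that the circuit prepares from the all-zero state. -/
def Circuit.state {Q : Type} [Fintype Q] [DecidableEq Q] (C : Circuit Q) : (Q → Bool) → ℂ :=
  fun x => C.toMatrix x (zeroState Q)

/-- Born rule: run the circuit on the all-zero state and measure qubit `q` in the computational
basis (`false` is the outcome `0`); the probability of outcome `v`. -/
def Circuit.outcomeProb {Q : Type} [Fintype Q] [DecidableEq Q] (C : Circuit Q) (q : Q)
    (v : Bool) : ℝ :=
  ∑ x : Q → Bool, if x q = v then ‖C.state x‖ ^ 2 else 0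

/-- The law of the measurement outcome. -/
def Circuit.outcomeLaw {Q : Type} [Fintype Q] [DecidableEq Q] (C : Circuit Q) (q : Q) :
    MeasureTheory.Measure Bool :=
  ∑ v : Bool, ENNReal.ofReal (C.outcomeProb q v) • MeasureTheory.Measure.dirac v

/-! ### The Hadamard test

The qubits of the test are `Option Q`: the control qubit `none` and the qubits `some q`. -/

/-- A one-qubit matrix acting on the control qubit. -/
def onControl {Q : Type} [Fintype Q] [DecidableEq Q] (h : Matrix Bool Bool ℂ) :
    Matrix (Option Q → Bool) (Option Q → Bool) ℂ := fun x y =>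
  if ∀ q, x (some q) = y (some q) then h (x none) (y none) else 0

/-- Controlled-`U` with control qubit `none`. -/
def controlled {Q : Type} [Fintype Q] [DecidableEq Q] (U : Matrix (Q → Bool) (Q → Bool) ℂ) :
    Matrix (Option Q → Bool) (Option Q → Bool) ℂ := fun x y =>
  if x none = y none then
    (if x none = true then U (fun q => x (some q)) (fun q => y (some q))
      else if ∀ q, x (some q) = y (some q) then 1 else 0)
  else 0

/-- The Hadamard gate. -/
def hadamard : Matrix Bool Bool ℂ := fun a b =>
  if a = true ∧ b = true then -(((Real.sqrt 2)⁻¹ : ℝ) : ℂ) else (((Real.sqrt 2)⁻¹ : ℝ) : ℂ)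

/-- The identity (for `im = false`) or the gate `diag(1, -i)` (for `im = true`). -/
def phase (im : Bool) : Matrix Bool Bool ℂ :=
  Matrix.diagonal (fun a => if a = true ∧ im = true then -Complex.I else 1)

/-- The circuit `T` implements the Hadamard test of `{|0⟩, U}`: Hadamard gate on the control
qubit, controlled-`U`, a phase gate on the control qubit if the imaginary part is wanted, and
again a Hadamard gate.  Measuring the control qubit then gives `0` with probability
`(1 + Re ⟨0|U|0⟩)/2` for `im = false`, and `(1 + Im ⟨0|U|0⟩)/2` for `im = true`. -/
def IsHadamardTest {Q : Type} [Fintype Q] [DecidableEq Q] (T : Circuit (Option Q)) (im : Bool)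
    (U : Matrix (Q → Bool) (Q → Bool) ℂ) : Prop :=
  T.toMatrix = onControl hadamard * onControl (phase im) * controlled U * onControl hadamard

/-! ### The linear system and its approximate solutions -/

/-- The matrix `A = ∑ⱼ ‖aⱼ‖ |aⱼ⟩⟨j|`, where `|aⱼ⟩ = Uⱼ|0⟩`. -/
def sysMatrix {n M : ℕ} (U : Fin M → Circuit (Fin n)) (a : Fin M → ℝ) :
    Matrix (Fin n → Bool) (Fin M) ℂ := fun x j => (a j : ℂ) * (U j).state x

/-- `y` satisfies `‖A† y - c‖ - min_z ‖A† z - c‖ ≤ ε`. -/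
def IsApproxSolution {m : Type} [Fintype m] {M : ℕ} (A : Matrix m (Fin M) ℂ) (c : Fin M → ℂ)
    (ε : ℝ) (y : m → ℂ) : Prop :=
  l2norm (A.conjTranspose.mulVec y - c) - (⨅ z : m → ℂ, l2norm (A.conjTranspose.mulVec z - c)) ≤ ε

/-- `Γ₂ = maxⱼ ‖aⱼ‖²`. -/
def gammaTwo {M : ℕ} (a : Fin M → ℝ) : ℝ := ⨆ j, a j ^ 2

/-- `α* = V⁺ c` with `V = A† A`. -/
def alphaStar {m : Type} [Fintype m] {M : ℕ} (A : Matrix m (Fin M) ℂ) (c : Fin M → ℂ) :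
    Fin M → ℂ :=
  (pinv (A.conjTranspose * A)).mulVec c

/-! ### The algorithm -/

/-- The shift `λ = ε / (2 ‖A⁺‖⁸ ‖A‖⁴ ‖c‖)`. -/
def shift {m : Type} [Fintype m] [DecidableEq m] {M : ℕ} (A : Matrix m (Fin M) ℂ)
    (c : Fin M → ℂ) (ε : ℝ) : ℝ :=
  ε / (2 * specNorm (pinv A) ^ 8 * specNorm A ^ 4 * l2norm c)

/-- `κ¹² ‖A⁺‖⁴ ‖c‖² (‖A‖² ‖α*‖ + ε + ‖c‖)² / ε⁴`. -/
def mainFactor {m : Type} [Fintype m] [DecidableEq m] {M : ℕ} (A : Matrix m (Fin M) ℂ)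
    (c : Fin M → ℂ) (ε : ℝ) : ℝ :=
  cond A ^ 12 * specNorm (pinv A) ^ 4 * l2norm c ^ 2
    * (specNorm A ^ 2 * l2norm (alphaStar A c) + ε + l2norm c) ^ 2 / ε ^ 4

/-- `T = C · M κ¹² ‖A⁺‖⁴ ‖c‖² (‖A‖² ‖α*‖ + ε + ‖c‖)² / ε⁴ + M / ‖A‖⁴`. -/
def sampleT {m : Type} [Fintype m] [DecidableEq m] {M : ℕ} (C : ℝ) (A : Matrix m (Fin M) ℂ)
    (c : Fin M → ℂ) (ε : ℝ) : ℝ :=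
  C * (M * mainFactor A c ε) + M / specNorm A ^ 4

/-- The number of repetitions of each Hadamard test: `Γ₂² T log(2/δ)`, rounded up, where `δ` is
the admitted failure probability. -/
def shots {m : Type} [Fintype m] [DecidableEq m] {M : ℕ} (C : ℝ) (A : Matrix m (Fin M) ℂ)
    (a : Fin M → ℝ) (c : Fin M → ℂ) (ε δ : ℝ) : ℕ :=
  ⌈gammaTwo a ^ 2 * sampleT C A c ε * Real.log (2 / δ)⌉₊

/-- The estimate of `⟨aⱼ|aₖ⟩` from the numbers `z j k im` of outcomes `0` among `S` runs. -/
def vHat {M : ℕ} (S : ℕ) (z : Fin M → Fin M → Bool → ℕ) (j k : Fin M) : ℂ :=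
  (2 * (z j k false : ℂ) / (S : ℂ) - 1) + (2 * (z j k true : ℂ) / (S : ℂ) - 1) * Complex.I

/-- The estimate `V̂ⱼₖ = ‖aⱼ‖ ‖aₖ‖ v̂ⱼₖ` of `V = A† A`. -/
def VHat {M : ℕ} (a : Fin M → ℝ) (S : ℕ) (z : Fin M → Fin M → Bool → ℕ) :
    Matrix (Fin M) (Fin M) ℂ := fun j k => (a j : ℂ) * (a k : ℂ) * vHat S z j k

/-- `Q̂ = V̂² + λ I`. -/
def QHat {M : ℕ} (a : Fin M → ℝ) (lam : ℝ) (S : ℕ) (z : Fin M → Fin M → Bool → ℕ) :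
    Matrix (Fin M) (Fin M) ℂ := VHat a S z ^ 2 + (lam : ℂ) • 1

/-- `α̂ = Q̂⁻¹ V̂ c`, for invertible `Q̂`. -/
def alphaHat {M : ℕ} (a : Fin M → ℝ) (c : Fin M → ℂ) (lam : ℝ) (S : ℕ)
    (z : Fin M → Fin M → Bool → ℕ) : Fin M → ℂ :=
  ((QHat a lam S z)⁻¹).mulVec ((VHat a S z).mulVec c)

/-- The measurement record: the outcome of run `r` of the Hadamard test `(j, k, im)`. -/
abbrev Record (M S : ℕ) : Type := Fin M × Fin M × Bool × Fin S → Bool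

/-- The law of the measurement record: all runs of all tests are independent, and each follows
the Born rule for the control qubit of its circuit. -/
def recordLaw {n M : ℕ} (test : Fin M → Fin M → Bool → Circuit (Option (Fin n))) (S : ℕ) :
    MeasureTheory.Measure (Record M S) :=
  MeasureTheory.Measure.pi (fun t => (test t.1 t.2.1 t.2.2.1).outcomeLaw none)

/-- The number of outcomes `0` of the test `(j, k, im)`. -/
def zeroCount {M S : ℕ} (ω : Record M S) (j k : Fin M) (im : Bool) : ℕ :=
  (Finset.univ.filter (fun r : Fin S => ω (j, k, im, r) = false)).card

/-! ### The classical part: straight-line programs with unit-cost complex arithmetic -/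

/-- An instruction of a program with registers `R`; the first register is the destination. -/
inductive Instr (R : Type) where
  | one (d : R)
  | imag (d : R)
  | conj (d x : R)
  | add (d x y : R)
  | sub (d x y : R)
  | mul (d x y : R)
  | div (d x y : R)

open Classical in
/-- The effect of an instruction on the memory. -/
def Instr.exec {R : Type} (mem : R → ℂ) : Instr R → (R → ℂ)
  | .one d => Function.update mem d 1
  | .imag d => Function.update mem d Complex.I
  | .conj d x => Function.update mem d (star (mem x))
  | .add d x y => Function.update mem d (mem x + mem y)
  | .sub d x y => Function.update mem d (mem x - mem y)
  | .mul d x y => Function.update mem d (mem x * mem y)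
  | .div d x y => Function.update mem d (mem x / mem y)

/-- A straight-line program with input registers `I` and further registers `W`, which hold `0`
at the start; `out` names the registers that hold the outputs at the end. -/
structure Program (I O : Type) where
  W : Type
  code : List (Instr (I ⊕ W))
  out : O → I ⊕ W

/-- The output of a program. -/
def Program.eval {I O : Type} (P : Program I O) (input : I → ℂ) : O → ℂ := fun o =>
  (P.code.foldl Instr.exec (Sum.elim input (fun _ => 0))) (P.out o)

/-- The running time of a program: its number of instructions. -/
def Program.steps {I O : Type} (P : Program I O) : ℕ := P.code.length

/-- The inputs of the classical part of the algorithm. -/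
inductive PostInput (M : ℕ) where
  | count (j k : Fin M) (im : Bool)
  | shots
  | norm (j : Fin M)
  | shift
  | rhs (j : Fin M)

/-- The values of these inputs. -/
def postInput {M : ℕ} (a : Fin M → ℝ) (c : Fin M → ℂ) (lam : ℝ) (S : ℕ)
    (z : Fin M → Fin M → Bool → ℕ) : PostInput M → ℂ
  | .count j k im => (z j k im : ℂ)
  | .shots => (S : ℂ)
  | .norm j => (a j : ℂ)
  | .shift => (lam : ℂ)
  | .rhs j => c j

/-- The program carries out the classical part of the algorithm: from the measured counts it
computes `s = (α̂₁ ‖a₁‖, …, α̂_M ‖a_M‖)`, whatever the data for which `Q̂` is invertible. -/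
def ComputesCoefficients {M : ℕ} (P : Program (PostInput M) (Fin M)) : Prop :=
  ∀ (a : Fin M → ℝ) (c : Fin M → ℂ) (lam : ℝ) (S : ℕ) (z : Fin M → Fin M → Bool → ℕ),
    IsUnit (QHat a lam S z).det →
      ∀ j, P.eval (postInput a c lam S z) j = alphaHat a c lam S z j * (a j : ℂ)

/-- The running time of the hybrid algorithm: every run of a Hadamard test costs the depth of its
circuit and one step for the measurement and the update of its counter; then the classical
program is executed. -/
def runTime {n M : ℕ} (test : Fin M → Fin M → Bool → Circuit (Option (Fin n))) (S : ℕ)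
    (P : Program (PostInput M) (Fin M)) : ℕ :=
  (∑ j, ∑ k, ∑ im, S * ((test j k im).depth + 1)) + P.steps

/-- The rate `Γ₂² M³ κ¹² ‖A⁺‖⁴ ‖c‖² (‖A‖² ‖α*‖ + ε + ‖c‖)² / ε⁴ + Γ₂² M³ / ‖A‖⁴`. -/
def rate {m : Type} [Fintype m] [DecidableEq m] {M : ℕ} (A : Matrix m (Fin M) ℂ)
    (a : Fin M → ℝ) (c : Fin M → ℂ) (ε : ℝ) : ℝ :=
  gammaTwo a ^ 2 * M ^ 3 * mainFactor A c ε + gammaTwo a ^ 2 * M ^ 3 / specNorm A ^ 4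

end SkewedLS

end

/-! Write V = A†A, Q = V² + λ, α_λ = Q⁻¹Vc, E = V̂ − V, and let P = A⁺A be the orthogonal projection
onto the range of A†. The residual of ŷ = Aα̂ splits as Vα̂ − c = V(α̂ − α_λ) + (Vα_λ − Pc) + (Pc −
c). The last term is no longer than the minimal residual (`residual_lower`). The middle one equals
−λV²Q⁻¹(A⁺(A⁺)†)²c, hence is at most λ‖A⁺‖⁴‖c‖ ≤ ε/2 by the choice of λ (`shifted_bias`). For the
first, Q̂(α̂ − α_λ) = Ec − (Q̂ − Q)α_λ, where ‖α_λ‖ ≤ ‖α*‖ and Q̂ inherits from Q a lower bound of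
order λ; this gives ε/2 as soon as ‖E‖²F is below an absolute constant (`perturbed_solution`,
`approximate_solution`).

The accuracy of V̂ comes from a net argument. For fixed u, v in the unit ball, Re u†Ev is a weighted
sum of independent centred signs whose squared weights add up to at most Γ₂²/S, with no factor M
(`sum_weight_sq_le`). Hoeffding's inequality and a union bound over at most 625^M pairs of net
points control ‖E‖ (`estimate_concentration`). The union bound costs one factor M in S; with 2M²
tests this is the M³ of the rate.

The Hadamard tests are exact circuits of depth O((n+1)(d+1)), because a controlled two-qubit gate is
a product of seven gates: diagonalize the gate, then write the controlled diagonal part with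
controlled phases and two CNOTs (`GateProd.controlled_gate`). The classical part solves the shifted
system in O(M³) operations by Gram–Schmidt on the rows, which needs neither branching nor square
roots (`exists_program`). In item 3 the terms M² and M³ are absorbed because M³ ≤ R
(`cube_le_rate`). -/

noncomputable section

namespace SkewedLS

open Matrix

set_option linter.unusedSectionVars false

/-! ### Matrices acting on a subset of the qubits -/

section Embed

variable {Q : Type} [Fintype Q] [DecidableEq Q]

/-- A matrix on the qubits of `s`, tensored with the identity on the other qubits. -/
def embed (s : Finset Q) (m : Matrix (s → Bool) (s → Bool) ℂ) :
    Matrix (Q → Bool) (Q → Bool) ℂ := fun x y =>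
  if ∀ i, i ∉ s → x i = y i then m (fun i => x i) (fun i => y i) else 0

/-- The assignment that is `a` on `s` and `x` elsewhere. -/
def glue (s : Finset Q) (a : s → Bool) (x : Q → Bool) : Q → Bool := fun i =>
  if h : i ∈ s then a ⟨i, h⟩ else x i

lemma glue_restrict (s : Finset Q) (a : s → Bool) (x : Q → Bool) :
    (fun i : s => glue s a x i) = a := by
  funext i; simp [glue]

lemma glue_of_notMem {s : Finset Q} (a : s → Bool) (x : Q → Bool) {i : Q} (h : i ∉ s) :
    glue s a x i = x i := by
  simp [glue, h]

/-- An assignment that agrees with `x` off `s` is determined by its arbitrary restriction to `s`.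
This turns products of embedded matrices into sums over `s` alone. -/
lemma sum_agree (s : Finset Q) (x : Q → Bool) (f : (Q → Bool) → ℂ) :
    (∑ z, if ∀ i, i ∉ s → x i = z i then f z else 0) = ∑ a : s → Bool, f (glue s a x) := by
  rw [← Finset.sum_filter]
  refine Finset.sum_bij' (fun z _ => fun i : s => z i) (fun a _ => glue s a x) ?_ ?_ ?_ ?_ ?_
  · simp
  · intro a _
    simp only [Finset.mem_filter, Finset.mem_univ, true_and]
    intro i hi
    rw [glue_of_notMem _ _ hi]
  · intro z hz
    simp only [Finset.mem_filter, Finset.mem_univ, true_and] at hz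
    funext i
    by_cases h : i ∈ s
    · simp [glue, h]
    · simp [glue, h, hz i h]
  · intro a _
    exact glue_restrict s a x
  · intro z hz
    simp only [Finset.mem_filter, Finset.mem_univ, true_and] at hz
    congr 1
    funext i
    by_cases h : i ∈ s
    · simp [glue, h]
    · simp [glue, h, hz i h]

lemma embed_glue (s : Finset Q) (m : Matrix (s → Bool) (s → Bool) ℂ) (a b : s → Bool)
    (x : Q → Bool) : embed s m (glue s a x) (glue s b x) = m a b := by
  unfold embed
  rw [if_pos, glue_restrict, glue_restrict]
  intro i hi
  rw [glue_of_notMem _ _ hi, glue_of_notMem _ _ hi]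

lemma embed_injective (s : Finset Q) : Function.Injective (embed s) := by
  intro m m' h
  ext a b
  rw [← embed_glue s m a b (fun _ => false), h, embed_glue]

lemma embed_mul (s : Finset Q) (m m' : Matrix (s → Bool) (s → Bool) ℂ) :
    embed s m * embed s m' = embed s (m * m') := by
  ext x y
  rw [Matrix.mul_apply]
  have h1 : ∀ z, embed s m x z * embed s m' z y =
      if ∀ i, i ∉ s → x i = z i then m (fun i => x i) (fun i => z i) * embed s m' z y else 0 := by
    intro z
    conv_lhs => rw [embed]
    split_ifs <;> simp
  simp_rw [h1]
  rw [sum_agree]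
  have h2 : ∀ a : s → Bool, embed s m' (glue s a x) y =
      if ∀ i, i ∉ s → x i = y i then m' a (fun i => y i) else 0 := by
    intro a
    unfold embed
    rw [glue_restrict]
    congr 1
    apply propext
    refine forall_congr' fun i => forall_congr' fun hi => ?_
    rw [glue_of_notMem _ _ hi]
  simp_rw [h2, glue_restrict]
  unfold embed
  split_ifs
  · rw [Matrix.mul_apply]
  · simp

lemma embed_diagonal (s : Finset Q) (d : (s → Bool) → ℂ) :
    embed s (diagonal d) = diagonal (fun x : Q → Bool => d (fun i => x i)) := by
  ext x y
  unfold embed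
  by_cases h : x = y
  · subst h; simp
  · rw [diagonal_apply_ne _ h]
    split_ifs with h1
    · apply diagonal_apply_ne
      intro h2
      apply h
      funext i
      by_cases hi : i ∈ s
      · exact congrFun h2 ⟨i, hi⟩
      · exact h1 i hi
    · rfl

lemma embed_one (s : Finset Q) : embed s (1 : Matrix (s → Bool) (s → Bool) ℂ) = 1 := by
  rw [← diagonal_one, embed_diagonal, diagonal_one]

lemma embed_conjTranspose (s : Finset Q) (m : Matrix (s → Bool) (s → Bool) ℂ) :
    embed s mᴴ = (embed s m)ᴴ := by
  ext x y
  simp only [embed, conjTranspose_apply]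
  by_cases h : ∀ i, i ∉ s → x i = y i
  · rw [if_pos h, if_pos (fun i hi => (h i hi).symm)]
  · rw [if_neg h, if_neg (fun h' => h (fun i hi => (h' i hi).symm)), star_zero]

/-- `embed s` is multiplicative, unital, compatible with adjoints and injective. The forward
direction certifies a gate from the unitarity of the large matrix, without computing with the small
one. -/
lemma embed_mem_unitaryGroup_iff (s : Finset Q) (m : Matrix (s → Bool) (s → Bool) ℂ) :
    embed s m ∈ unitaryGroup (Q → Bool) ℂ ↔ m ∈ unitaryGroup (s → Bool) ℂ := by
  rw [mem_unitaryGroup_iff, mem_unitaryGroup_iff, star_eq_conjTranspose, star_eq_conjTranspose,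
    ← embed_conjTranspose, embed_mul, ← embed_one s]
  exact (embed_injective s).eq_iff

/-- A criterion for locality: entries vanish unless the assignments agree off `s`, and otherwise
depend only on the restrictions to `s`. The small matrix is then read off with the value `false` on
all other qubits. -/
lemma exists_eq_embed (s : Finset Q) (X : Matrix (Q → Bool) (Q → Bool) ℂ)
    (h0 : ∀ x y, X x y ≠ 0 → ∀ i, i ∉ s → x i = y i)
    (h1 : ∀ x y x' y', (∀ i, i ∉ s → x i = y i) → (∀ i, i ∉ s → x' i = y' i) →
      (∀ i ∈ s, x i = x' i) → (∀ i ∈ s, y i = y' i) → X x y = X x' y') :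
    ∃ m, X = embed s m := by
  refine ⟨fun a b => X (glue s a (fun _ => false)) (glue s b (fun _ => false)), ?_⟩
  ext x y
  unfold embed
  split_ifs with h
  · apply h1 _ _ _ _ h
    · intro i hi
      simp [glue, hi]
    · intro i hi
      simp [glue, hi]
    · intro i hi
      simp [glue, hi]
  · by_contra h2
    exact h (h0 x y h2)

end Embed

/-! ### Products of gates -/

section GateProd

variable {Q : Type} [Fintype Q] [DecidableEq Q]

/-- `X` is a product of at most `k` gates. -/
def GateProd (k : ℕ) (X : Matrix (Q → Bool) (Q → Bool) ℂ) : Prop :=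
  ∃ l : List (Gate Q), l.length ≤ k ∧ (l.map Gate.toMatrix).prod = X

lemma GateProd.one : GateProd 0 (1 : Matrix (Q → Bool) (Q → Bool) ℂ) :=
  ⟨[], le_rfl, rfl⟩

lemma GateProd.mono {k k' : ℕ} {X : Matrix (Q → Bool) (Q → Bool) ℂ} (h : GateProd k X)
    (hk : k ≤ k') : GateProd k' X := by
  obtain ⟨l, hl, h⟩ := h
  exact ⟨l, hl.trans hk, h⟩

lemma GateProd.mul {k k' : ℕ} {X Y : Matrix (Q → Bool) (Q → Bool) ℂ} (hX : GateProd k X)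
    (hY : GateProd k' Y) : GateProd (k + k') (X * Y) := by
  obtain ⟨l, hl, rfl⟩ := hX
  obtain ⟨l', hl', rfl⟩ := hY
  exact ⟨l ++ l', by simp; omega, by simp⟩

lemma Gate.toMatrix_eq_embed (g : Gate Q) : g.toMatrix = embed g.qubits g.mat := rfl

lemma Gate.toMatrix_mem (g : Gate Q) : g.toMatrix ∈ unitaryGroup (Q → Bool) ℂ := by
  rw [Gate.toMatrix_eq_embed, embed_mem_unitaryGroup_iff]
  exact g.unitary

lemma GateProd.embed {s : Finset Q} (hs : s.Nonempty) (hc : s.card ≤ 2)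
    {m : Matrix (s → Bool) (s → Bool) ℂ} (hm : m ∈ unitaryGroup (s → Bool) ℂ) :
    GateProd 1 (embed s m) :=
  ⟨[⟨s, hs, hc, m, hm⟩], le_rfl, by simp [Gate.toMatrix_eq_embed]⟩

lemma GateProd.of_local {s : Finset Q} (hs : s.Nonempty) (hc : s.card ≤ 2)
    {X : Matrix (Q → Bool) (Q → Bool) ℂ} (hX : X ∈ unitaryGroup (Q → Bool) ℂ)
    (h : ∃ m, X = SkewedLS.embed s m) : GateProd 1 X := by
  obtain ⟨m, rfl⟩ := h
  exact GateProd.embed hs hc ((embed_mem_unitaryGroup_iff s m).1 hX)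

lemma GateProd.conjTranspose {k : ℕ} {X : Matrix (Q → Bool) (Q → Bool) ℂ} (hX : GateProd k X) :
    GateProd k Xᴴ := by
  obtain ⟨l, hl, rfl⟩ := hX
  induction l generalizing k with
  | nil => simpa using GateProd.one.mono (Nat.zero_le k)
  | cons g l ih =>
    have h1 : GateProd 1 g.toMatrixᴴ := by
      rw [Gate.toMatrix_eq_embed, ← embed_conjTranspose]
      exact GateProd.embed g.nonempty g.card_le (Unitary.star_mem g.unitary)
    have h2 := ih le_rfl
    simp only [List.map_cons, List.prod_cons, conjTranspose_mul]
    exact (h2.mul h1).mono (by simpa using hl)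

lemma GateProd.exists_circuit {k : ℕ} {X : Matrix (Q → Bool) (Q → Bool) ℂ} (hX : GateProd k X) :
    ∃ C : Circuit Q, C.depth ≤ k ∧ C.toMatrix = X := by
  obtain ⟨l, hl, rfl⟩ := hX
  -- One gate per layer. The list is reversed because a circuit executes its head first, whereas the
  -- head of a product is the leftmost factor, which acts last.
  refine ⟨⟨l.reverse.map fun g => ⟨[g], List.pairwise_singleton _ _⟩⟩, by simpa [Circuit.depth],
    ?_⟩
  simp only [Circuit.toMatrix, List.foldl_map, List.foldl_reverse, Layer.toMatrix]
  simp [List.prod_eq_foldr, List.foldr_map]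

lemma list_prod_mem_unitary (l : List (Matrix (Q → Bool) (Q → Bool) ℂ))
    (h : ∀ X ∈ l, X ∈ unitaryGroup (Q → Bool) ℂ) : l.prod ∈ unitaryGroup (Q → Bool) ℂ :=
  Submonoid.list_prod_mem _ h

lemma Layer.toMatrix_mem (L : Layer Q) : L.toMatrix ∈ unitaryGroup (Q → Bool) ℂ := by
  apply list_prod_mem_unitary
  intro X hX
  obtain ⟨g, _, rfl⟩ := List.mem_map.1 hX
  exact g.toMatrix_mem

lemma foldl_layers (l : List (Layer Q)) (X : Matrix (Q → Bool) (Q → Bool) ℂ) :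
    l.foldl (fun acc L => L.toMatrix * acc) X
      = l.foldl (fun acc L => L.toMatrix * acc) 1 * X := by
  induction l generalizing X with
  | nil => simp
  | cons L l ih =>
    rw [List.foldl_cons, List.foldl_cons, ih, ih (L.toMatrix * 1), mul_one, Matrix.mul_assoc]

lemma Circuit.toMatrix_cons (L : Layer Q) (l : List (Layer Q)) :
    (Circuit.mk (L :: l)).toMatrix = (Circuit.mk l).toMatrix * L.toMatrix := by
  simp only [Circuit.toMatrix, List.foldl_cons, mul_one]
  exact foldl_layers l _

lemma Circuit.toMatrix_mem (C : Circuit Q) : C.toMatrix ∈ unitaryGroup (Q → Bool) ℂ := by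
  obtain ⟨l⟩ := C
  induction l with
  | nil => exact one_mem _
  | cons L l ih =>
    rw [Circuit.toMatrix_cons]
    exact mul_mem ih L.toMatrix_mem

lemma Layer.length_gates_le (L : Layer Q) : L.gates.length ≤ Fintype.card Q := by
  obtain ⟨l, hl⟩ := L
  -- The witness is the union of the supports, each of which has at least one qubit. The last clause
  -- passes disjointness from the single gates to this union, so that the cardinalities add in the
  -- induction.
  have key : ∀ l : List (Gate Q), l.Pairwise (fun g h => Disjoint g.qubits h.qubits) →
      ∃ s : Finset Q, l.length ≤ s.card ∧ ∀ t : Finset Q, (∀ g ∈ l, Disjoint t g.qubits) →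
        Disjoint t s := by
    intro l hl
    induction l with
    | nil => exact ⟨∅, by simp, by simp⟩
    | cons g l ih =>
      obtain ⟨h1, h2⟩ := List.pairwise_cons.1 hl
      obtain ⟨s, hs, hd⟩ := ih h2
      refine ⟨g.qubits ∪ s, ?_, ?_⟩
      · rw [Finset.card_union_of_disjoint (hd _ h1)]
        have := g.nonempty.card_pos
        simp only [List.length_cons]
        omega
      · intro t ht
        rw [Finset.disjoint_union_right]
        exact ⟨ht g (by simp), hd t fun g' hg' => ht g' (by simp [hg'])⟩
  obtain ⟨s, hs, -⟩ := key l hl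
  exact hs.trans (Finset.card_le_univ s)

end GateProd

/-! ### Block matrices with respect to the control qubit -/

section Blocks

variable {Q : Type} [Fintype Q] [DecidableEq Q]

/-- The matrix on the qubits `Option Q` with blocks `B a b` with respect to the control qubit. -/
def blk (B : Bool → Bool → Matrix (Q → Bool) (Q → Bool) ℂ) :
    Matrix (Option Q → Bool) (Option Q → Bool) ℂ := fun x y =>
  B (x none) (y none) (fun q => x (some q)) (fun q => y (some q))

lemma sum_option (f : (Option Q → Bool) → ℂ) :
    ∑ x, f x = ∑ b : Bool, ∑ z : Q → Bool, f (fun o => o.elim b z) := by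
  rw [← Fintype.sum_prod_type']
  symm
  refine Fintype.sum_equiv
    ⟨fun p o => o.elim p.1 p.2, fun x => (x none, fun q => x (some q)), ?_, ?_⟩ _ _ ?_
  · intro p; rfl
  · intro x; funext o; cases o <;> rfl
  · intro p; rfl

lemma blk_mul (B B' : Bool → Bool → Matrix (Q → Bool) (Q → Bool) ℂ) :
    blk B * blk B' = blk (fun a b => ∑ c, B a c * B' c b) := by
  ext x y
  rw [Matrix.mul_apply, sum_option]
  simp [blk, Matrix.mul_apply, Matrix.add_apply]

lemma blk_conjTranspose (B : Bool → Bool → Matrix (Q → Bool) (Q → Bool) ℂ) :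
    (blk B)ᴴ = blk (fun a b => (B b a)ᴴ) := rfl

lemma blk_one : blk (fun a b => if a = b then (1 : Matrix (Q → Bool) (Q → Bool) ℂ) else 0) = 1 := by
  ext x y
  have : x = y ↔ x none = y none ∧ (fun q => x (some q)) = fun q => y (some q) := by
    constructor
    · rintro rfl; simp
    · rintro ⟨h1, h2⟩
      funext o
      cases o with
      | none => exact h1
      | some q => exact congrFun h2 q
  change (if x none = y none then (1 : Matrix (Q → Bool) (Q → Bool) ℂ) else 0) _ _ = _
  rw [Matrix.one_apply]
  by_cases h1 : x none = y none
  · by_cases h2 : (fun q => x (some q)) = fun q => y (some q)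
    · rw [if_pos (this.2 ⟨h1, h2⟩), if_pos h1, h2, Matrix.one_apply_eq]
    · rw [if_neg (fun h => h2 (this.1 h).2), if_pos h1, Matrix.one_apply_ne h2]
  · rw [if_neg (fun h => h1 (this.1 h).1), if_neg h1]; rfl

lemma controlled_eq_blk (U : Matrix (Q → Bool) (Q → Bool) ℂ) :
    controlled U = blk (fun a b => if a = b then (if a = true then U else 1) else 0) := by
  ext x y
  simp only [controlled, blk]
  split_ifs with h1 h2 h3
  · rfl
  · rw [Matrix.one_apply, if_pos (funext h3)]
  · rw [Matrix.one_apply, if_neg (fun h => h3 (congrFun h))]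
  · rfl

lemma onControl_eq_blk (h : Matrix Bool Bool ℂ) :
    onControl (Q := Q) h = blk (fun a b => h a b • 1) := by
  ext x y
  simp only [onControl, blk, Matrix.smul_apply, Matrix.one_apply, smul_eq_mul, mul_ite, mul_one,
    mul_zero]
  congr 1
  exact propext funext_iff.symm

/-- The matrix `X` on the qubits other than the control qubit. -/
def onSys (X : Matrix (Q → Bool) (Q → Bool) ℂ) :
    Matrix (Option Q → Bool) (Option Q → Bool) ℂ :=
  blk (fun a b => if a = b then X else 0)

lemma controlled_mul (U V : Matrix (Q → Bool) (Q → Bool) ℂ) :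
    controlled (U * V) = controlled U * controlled V := by
  simp only [controlled_eq_blk, blk_mul]
  congr 1
  funext a b
  cases a <;> cases b <;> simp

lemma controlled_one : controlled (1 : Matrix (Q → Bool) (Q → Bool) ℂ) = 1 := by
  rw [controlled_eq_blk, ← blk_one]
  simp

lemma controlled_conjTranspose (U : Matrix (Q → Bool) (Q → Bool) ℂ) :
    controlled Uᴴ = (controlled U)ᴴ := by
  simp only [controlled_eq_blk, blk_conjTranspose]
  congr 1
  funext a b
  cases a <;> cases b <;> simp

lemma controlled_mem {U : Matrix (Q → Bool) (Q → Bool) ℂ} (hU : U ∈ unitaryGroup (Q → Bool) ℂ) :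
    controlled U ∈ unitaryGroup (Option Q → Bool) ℂ := by
  rw [mem_unitaryGroup_iff, star_eq_conjTranspose] at *
  rw [← controlled_conjTranspose, ← controlled_mul, hU, controlled_one]

lemma onSys_mul (U V : Matrix (Q → Bool) (Q → Bool) ℂ) :
    onSys (U * V) = onSys U * onSys V := by
  simp only [onSys, blk_mul]
  congr 1
  funext a b
  cases a <;> cases b <;> simp

lemma onSys_conjTranspose (U : Matrix (Q → Bool) (Q → Bool) ℂ) :
    onSys Uᴴ = (onSys U)ᴴ := by
  simp only [onSys, blk_conjTranspose]
  congr 1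
  funext a b
  cases a <;> cases b <;> simp

lemma onSys_mem {U : Matrix (Q → Bool) (Q → Bool) ℂ} (hU : U ∈ unitaryGroup (Q → Bool) ℂ) :
    onSys U ∈ unitaryGroup (Option Q → Bool) ℂ := by
  rw [mem_unitaryGroup_iff, star_eq_conjTranspose] at *
  rw [← onSys_conjTranspose, ← onSys_mul, hU]
  exact blk_one

/-- If the control is `0`, the outer factors cancel by W W† = 1, so they need not be controlled.
Only the diagonal part of a diagonalized gate needs a control. -/
lemma controlled_conj {W X : Matrix (Q → Bool) (Q → Bool) ℂ} (hW : W * Wᴴ = 1) :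
    controlled (W * X * Wᴴ) = onSys W * controlled X * (onSys W)ᴴ := by
  rw [← onSys_conjTranspose]
  simp only [controlled_eq_blk, onSys, blk_mul]
  congr 1
  funext a b
  cases a <;> cases b <;> simp [hW]

lemma controlled_diagonal (f : (Q → Bool) → ℂ) :
    controlled (diagonal f)
      = diagonal (fun x : Option Q → Bool => if x none = true then f (fun q => x (some q)) else 1) := by
  ext x y
  by_cases h : x = y
  · subst h
    simp [controlled]
  · rw [diagonal_apply_ne _ h]
    simp only [controlled]
    split_ifs with h1 h2 h3
    · apply diagonal_apply_ne
      intro h4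
      apply h
      funext o
      cases o with
      | none => exact h1
      | some q => exact congrFun h4 q
    · exfalso
      apply h
      funext o
      cases o with
      | none => exact h1
      | some q => exact h3 q
    · rfl
    · rfl

/-- The control adds one qubit to the support; hence a controlled one-qubit gate is itself an
admissible gate. -/
lemma exists_controlled_eq_embed (s : Finset Q) (m : Matrix (s → Bool) (s → Bool) ℂ) :
    ∃ m', controlled (embed s m) = embed (insert none (s.map Function.Embedding.some)) m' := by
  apply exists_eq_embed
  · intro x y h o ho
    simp only [Finset.mem_insert, Finset.mem_map, Function.Embedding.some_apply, not_or,
      not_exists, not_and] at ho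
    cases o with
    | none => exact absurd rfl ho.1
    | some q =>
      have hq : q ∉ s := fun hq => ho.2 q hq rfl
      unfold controlled at h
      split_ifs at h with h1 h2 h3
      · unfold embed at h
        by_contra h4
        apply h
        rw [if_neg]
        exact fun h5 => h4 (h5 q hq)
      · exact h3 q
      · exact absurd rfl h
      · exact absurd rfl h
  · intro x y x' y' h h' hx hy
    have e1 : x none = x' none := hx none (by simp)
    have e2 : y none = y' none := hy none (by simp)
    have ex : ∀ q ∈ s, x (some q) = x' (some q) := fun q hq => hx (some q) (by simp [hq])
    have ey : ∀ q ∈ s, y (some q) = y' (some q) := fun q hq => hy (some q) (by simp [hq])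
    have o1 : ∀ q, q ∉ s → x (some q) = y (some q) := fun q hq => h (some q) (by simp [hq])
    have o2 : ∀ q, q ∉ s → x' (some q) = y' (some q) := fun q hq => h' (some q) (by simp [hq])
    have e3 : (∀ q, x (some q) = y (some q)) ↔ ∀ q, x' (some q) = y' (some q) := by
      refine forall_congr' fun q => ?_
      by_cases hq : q ∈ s
      · rw [ex q hq, ey q hq]
      · simp [o1 q hq, o2 q hq]
    have e4 : embed s m (fun q => x (some q)) (fun q => y (some q))
        = embed s m (fun q => x' (some q)) (fun q => y' (some q)) := by
      unfold embed
      rw [if_pos o1, if_pos o2]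
      congr 1
      · funext q; exact ex q q.2
      · funext q; exact ey q q.2
    simp only [controlled, e1, e2, e3, e4]

lemma exists_onSys_eq_embed (s : Finset Q) (m : Matrix (s → Bool) (s → Bool) ℂ) :
    ∃ m', onSys (embed s m) = embed (s.map Function.Embedding.some) m' := by
  have hv : ∀ x y : Option Q → Bool, onSys (embed s m) x y =
      if x none = y none then embed s m (fun q => x (some q)) (fun q => y (some q)) else 0 := by
    intro x y
    simp only [onSys, blk]
    split_ifs <;> rfl
  apply exists_eq_embed
  · intro x y h o ho
    rw [hv] at h
    split_ifs at h with h1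
    · cases o with
      | none => exact h1
      | some q =>
        have hq : q ∉ s := fun hq => ho (by simp [hq])
        unfold embed at h
        by_contra h4
        apply h
        rw [if_neg]
        exact fun h5 => h4 (h5 q hq)
    · exact absurd rfl h
  · intro x y x' y' h h' hx hy
    have ex : ∀ q ∈ s, x (some q) = x' (some q) := fun q hq => hx (some q) (by simp [hq])
    have ey : ∀ q ∈ s, y (some q) = y' (some q) := fun q hq => hy (some q) (by simp [hq])
    have o1 : ∀ q, q ∉ s → x (some q) = y (some q) := fun q hq => h (some q) (by simp [hq])
    have o2 : ∀ q, q ∉ s → x' (some q) = y' (some q) := fun q hq => h' (some q) (by simp [hq])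
    rw [hv, hv, if_pos (h none (by simp)), if_pos (h' none (by simp))]
    unfold embed
    rw [if_pos o1, if_pos o2]
    congr 1
    · funext q; exact ex q q.2
    · funext q; exact ey q q.2

end Blocks

/-! ### Diagonalization of unitary matrices -/

/-- The unit circle is infinite and the characteristic polynomial has finitely many roots. The point
`t` is where the Cayley transform is centred. -/
lemma exists_unit_det_ne_zero {ι : Type} [Fintype ι] [DecidableEq ι] (m : Matrix ι ι ℂ) :
    ∃ t : ℂ, star t * t = 1 ∧ IsUnit (t • (1 : Matrix ι ι ℂ) - m).det := by
  have hinf : (Metric.sphere (0 : ℂ) 1).Infinite := by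
    have hc : IsPreconnected (Metric.sphere (0 : ℂ) 1) :=
      isPreconnected_sphere (by simp) 0 1
    have hn : (Metric.sphere (0 : ℂ) 1).Nontrivial :=
      ⟨1, by simp, -1, by simp, by norm_num⟩
    exact hc.infinite_of_nontrivial hn
  have hfin : {t : ℂ | m.charpoly.IsRoot t}.Finite :=
    Polynomial.finite_setOfPred_isRoot (Matrix.charpoly_monic m).ne_zero
  obtain ⟨t, ht, htr⟩ := (hinf.sdiff hfin).nonempty
  refine ⟨t, ?_, ?_⟩
  · have : ‖t‖ = 1 := by simpa using ht
    have h2 := Complex.conj_mul' t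
    rw [this] at h2
    simpa using h2
  · rw [isUnit_iff_ne_zero]
    intro h
    apply htr
    change m.charpoly.eval t = 0
    rw [Matrix.eval_charpoly, ← h]
    congr 2
    simp [Matrix.scalar_apply, Matrix.smul_one_eq_diagonal]

/-- A unitary matrix is unitarily diagonalizable (by way of its Cayley transform). -/
lemma exists_diagonalization {ι : Type} [Fintype ι] [DecidableEq ι] {m : Matrix ι ι ℂ}
    (hm : m ∈ unitaryGroup ι ℂ) :
    ∃ W ∈ unitaryGroup ι ℂ, ∃ d : ι → ℂ, (∀ i, ‖d i‖ = 1) ∧ m = W * diagonal d * Wᴴ := by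
  obtain ⟨t, ht, hu⟩ := exists_unit_det_ne_zero m
  set X : Matrix ι ι ℂ := t • 1 - m with hX
  set Y : Matrix ι ι ℂ := t • 1 + m with hY
  have hmm : mᴴ * m = 1 := mem_unitaryGroup_iff'.1 hm
  have hXX : X * X⁻¹ = 1 := mul_nonsing_inv _ hu
  have hXX' : X⁻¹ * X = 1 := nonsing_inv_mul _ hu
  -- Both |t| = 1 and m†m = 1 enter here: the constant terms cancel, and t̄m − t m† is left. This
  -- identity makes i Y X⁻¹ Hermitian.
  have hkey : Xᴴ * Y = -(Yᴴ * X) := by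
    simp only [hX, hY, conjTranspose_sub, conjTranspose_add, conjTranspose_smul,
      conjTranspose_one, Matrix.sub_mul, Matrix.add_mul, Matrix.mul_add, Matrix.mul_sub,
      Matrix.smul_mul, Matrix.mul_smul, Matrix.one_mul, Matrix.mul_one, hmm]
    have ht' : t * star t = 1 := by rw [mul_comm, ht]
    rw [smul_sub, smul_add, smul_smul, ht', one_smul]
    abel
  set H : Matrix ι ι ℂ := Complex.I • (Y * X⁻¹) with hHdef
  have hXiH : (X⁻¹)ᴴ * Xᴴ = 1 := by rw [← conjTranspose_mul, hXX, conjTranspose_one]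
  have hH : H.IsHermitian := by
    have h1 : (X⁻¹)ᴴ * Yᴴ = -(Y * X⁻¹) := by
      calc (X⁻¹)ᴴ * Yᴴ = (X⁻¹)ᴴ * (Yᴴ * X) * X⁻¹ := by
            rw [Matrix.mul_assoc, Matrix.mul_assoc, hXX, Matrix.mul_one]
        _ = -((X⁻¹)ᴴ * Xᴴ * (Y * X⁻¹)) := by
            rw [← neg_neg (Yᴴ * X), ← hkey, Matrix.mul_neg, Matrix.neg_mul]
            simp only [Matrix.mul_assoc]
        _ = -(Y * X⁻¹) := by rw [hXiH, Matrix.one_mul]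
    unfold Matrix.IsHermitian
    rw [hHdef, conjTranspose_smul, conjTranspose_mul, h1]
    simp
  have hHX : H * X = Complex.I • Y := by
    rw [hHdef, Matrix.smul_mul, Matrix.mul_assoc, hXX', Matrix.mul_one]
  set W : Matrix ι ι ℂ := (hH.eigenvectorUnitary : Matrix ι ι ℂ) with hW
  have hWmem : W ∈ unitaryGroup ι ℂ := hH.eigenvectorUnitary.2
  have hWW : W * Wᴴ = 1 := mem_unitaryGroup_iff.1 hWmem
  have hWW' : Wᴴ * W = 1 := mem_unitaryGroup_iff'.1 hWmem
  set L : Matrix ι ι ℂ := diagonal (fun i => ((hH.eigenvalues i : ℝ) : ℂ)) with hL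
  have hspec : H = W * L * Wᴴ := by
    have := hH.spectral_theorem
    rw [Unitary.conjStarAlgAut_apply] at this
    exact this
  set m' : Matrix ι ι ℂ := Wᴴ * m * W with hm'
  have hback : m = W * m' * Wᴴ := by
    rw [hm']
    calc m = (W * Wᴴ) * m * (W * Wᴴ) := by rw [hWW]; simp
      _ = _ := by simp only [Matrix.mul_assoc]
  -- The relation H X = i Y in an eigenbasis of H; read entrywise, it will show that `m` is diagonal
  -- there as well.
  have hrel : L * (t • 1 - m') = Complex.I • (t • 1 + m') := by
    have h1 : Wᴴ * (H * X) * W = Wᴴ * (Complex.I • Y) * W := by rw [hHX]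
    have h2 : Wᴴ * (H * X) * W = L * (t • 1 - m') := by
      rw [hspec]
      calc Wᴴ * (W * L * Wᴴ * X) * W = (Wᴴ * W) * L * (Wᴴ * X * W) := by
            simp only [Matrix.mul_assoc]
        _ = L * (Wᴴ * X * W) := by rw [hWW', Matrix.one_mul]
        _ = _ := by
            rw [hX, Matrix.mul_sub, Matrix.sub_mul]
            simp [hWW', hm']
    have h3 : Wᴴ * (Complex.I • Y) * W = Complex.I • (t • 1 + m') := by
      rw [hY]
      simp [Matrix.mul_add, Matrix.add_mul, hWW', hm']
    rw [← h2, h1, h3]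
  have hdiag : ∀ i j, i ≠ j → m' i j = 0 := by
    intro i j hij
    have := congrFun (congrFun hrel i) j
    rw [hL, diagonal_mul] at this
    simp only [Matrix.sub_apply, Matrix.add_apply, Matrix.smul_apply, one_apply_ne hij, smul_eq_mul, mul_zero,
      zero_sub, zero_add] at this
    -- The eigenvalue is real, so the factor with `Complex.I` has imaginary part 1 and cannot
    -- vanish.
    have h2 : ((hH.eigenvalues i : ℂ) + Complex.I) * m' i j = 0 := by linear_combination -this
    rcases mul_eq_zero.1 h2 with h3 | h3
    · have := congrArg Complex.im h3
      simp at this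
    · exact h3
  have hm'eq : m' = diagonal (fun i => m' i i) := by
    ext i j
    by_cases h : i = j
    · subst h; simp
    · rw [diagonal_apply_ne _ h, hdiag i j h]
  have hm'u : m'ᴴ * m' = 1 := by
    rw [hm']
    simp only [conjTranspose_mul, conjTranspose_conjTranspose]
    calc Wᴴ * (mᴴ * W) * (Wᴴ * m * W) = Wᴴ * mᴴ * (W * Wᴴ) * m * W := by
          simp only [Matrix.mul_assoc]
      _ = Wᴴ * (mᴴ * m) * W := by rw [hWW, Matrix.mul_one]; simp only [Matrix.mul_assoc]
      _ = 1 := by rw [hmm, Matrix.mul_one, hWW']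
  refine ⟨W, hWmem, fun i => m' i i, ?_, by rw [← hm'eq]; exact hback⟩
  intro i
  have := congrFun (congrFun hm'u i) i
  rw [hm'eq, diagonal_conjTranspose, diagonal_mul_diagonal, diagonal_apply_eq,
    one_apply_eq] at this
  have h2 := Complex.conj_mul' (m' i i)
  simp only [Pi.star_apply, RCLike.star_def] at this
  rw [this] at h2
  have h3 : ‖m' i i‖ ^ 2 = 1 := by exact_mod_cast h2.symm
  exact (pow_eq_one_iff_of_nonneg (norm_nonneg _) two_ne_zero).1 h3

/-! ### The controlled two-qubit gate -/

/-- The diagonal of a two-qubit gate is a product of phases of the two bits and of their sum. -/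
lemma exists_phases (z : Bool → Bool → ℂ) (hz : ∀ a b, ‖z a b‖ = 1) :
    ∃ f g h : Bool → ℂ, (∀ a, ‖f a‖ = 1) ∧ (∀ a, ‖g a‖ = 1) ∧ (∀ a, ‖h a‖ = 1) ∧
      ∀ a b, z a b = f a * g b * h (xor a b) := by
  have hne : ∀ a b, z a b ≠ 0 := fun a b h => by simpa [h] using hz a b
  -- With the normalization f(0) = z₀₀ and g(0) = h(0) = 1, the three remaining equations are z₁₀ =
  -- f(1)h(1), z₀₁ = z₀₀g(1)h(1) and z₁₁ = f(1)g(1). Solving them takes one square root, `r`.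
  obtain ⟨r, hr⟩ := IsAlgClosed.exists_pow_nat_eq
    (z false true * z true false * z true true / z false false) (n := 2) (by norm_num)
  have hr1 : ‖r‖ = 1 := by
    have := congrArg norm hr
    simp only [norm_pow, norm_mul, norm_div, hz, mul_one, div_one] at this
    exact (pow_eq_one_iff_of_nonneg (norm_nonneg _) two_ne_zero).1 this
  have h00 := hne false false
  have h01 := hne false true
  have h10 := hne true false
  have h11 := hne true true
  have hr' : r ^ 2 * z false false = z false true * z true false * z true true := by
    rw [hr]; field_simp
  refine ⟨fun a => if a then r * z false false / z false true else z false false,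
    fun b => if b then r / z true false else 1,
    fun b => if b then r / z true true else 1, ?_, ?_, ?_, ?_⟩
  · intro a; cases a <;> simp [hz, hr1]
  · intro a; cases a <;> simp [hz, hr1]
  · intro a; cases a <;> simp [hz, hr1]
  · intro a b
    cases a <;> cases b
    · simp
    · simp only [Bool.xor_true, Bool.not_false, if_true, if_false,
        Bool.false_eq_true]
      field_simp
      linear_combination -hr'
    · simp only [Bool.xor_false, if_true, if_false, Bool.false_eq_true]
      field_simp
      linear_combination -hr'
    · simp only [Bool.xor_self, if_true, if_false, Bool.false_eq_true]
      field_simp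
      linear_combination -hr'

section ControlledGate

variable {Q : Type} [Fintype Q] [DecidableEq Q]

lemma GateProd.diagonal {s : Finset Q} (hs : s.Nonempty) (hc : s.card ≤ 2)
    (d : (s → Bool) → ℂ) (hd : ∀ a, ‖d a‖ = 1) {f : (Q → Bool) → ℂ}
    (hf : ∀ x, f x = d (fun i => x i)) : GateProd 1 (Matrix.diagonal f) := by
  have h1 : Matrix.diagonal f = SkewedLS.embed s (Matrix.diagonal d) := by
    rw [embed_diagonal]
    congr 1
    exact funext hf
  rw [h1]
  apply GateProd.embed hs hc
  rw [mem_unitaryGroup_iff, star_eq_conjTranspose, diagonal_conjTranspose, diagonal_mul_diagonal,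
    ← Matrix.diagonal_one]
  congr 1
  funext a
  have := Complex.mul_conj' (d a)
  rw [hd a] at this
  simpa using this

/-- The controlled-NOT map on basis states, with control `p` and target `q`. -/
def cnotMap (p q : Q) (x : Q → Bool) : Q → Bool := Function.update x q (xor (x p) (x q))

lemma cnotMap_cnotMap {p q : Q} (hpq : p ≠ q) (x : Q → Bool) :
    cnotMap p q (cnotMap p q x) = x := by
  funext i
  unfold cnotMap
  by_cases h : i = q
  · subst h
    simp [Function.update_of_ne hpq]
  · simp [Function.update_of_ne h]

/-- The controlled-NOT gate with control `p` and target `q`. -/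
def cnot (p q : Q) : Matrix (Q → Bool) (Q → Bool) ℂ := fun x y =>
  if y = cnotMap p q x then 1 else 0

/-- CNOT permutes the basis by an involution, so conjugation by it permutes the diagonal. With `f =
1` this is also the source of its unitarity. -/
lemma cnot_mul_diagonal_mul_cnot {p q : Q} (hpq : p ≠ q) (f : (Q → Bool) → ℂ) :
    cnot p q * diagonal f * cnot p q = diagonal (fun x => f (cnotMap p q x)) := by
  ext x y
  rw [Matrix.mul_apply]
  simp_rw [mul_diagonal, cnot]
  simp only [ite_mul, one_mul, zero_mul, Finset.sum_ite_eq', Finset.mem_univ, if_true]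
  rw [cnotMap_cnotMap hpq]
  by_cases h : x = y
  · subst h; simp
  · rw [diagonal_apply_ne _ h, if_neg (fun h' => h h'.symm), mul_zero]

lemma cnot_mem {p q : Q} (hpq : p ≠ q) : cnot p q ∈ unitaryGroup (Q → Bool) ℂ := by
  have h1 : (cnot p q)ᴴ = cnot p q := by
    ext x y
    rw [conjTranspose_apply]
    unfold cnot
    have : x = cnotMap p q y ↔ y = cnotMap p q x :=
      ⟨fun h => by rw [h, cnotMap_cnotMap hpq], fun h => by rw [h, cnotMap_cnotMap hpq]⟩
    simp only [this]
    split_ifs <;> simp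
  rw [mem_unitaryGroup_iff, star_eq_conjTranspose, h1]
  have := cnot_mul_diagonal_mul_cnot hpq (fun _ => 1)
  rwa [Matrix.diagonal_one, Matrix.mul_one] at this

lemma GateProd.cnot {p q : Q} (hpq : p ≠ q) : GateProd 1 (cnot p q) := by
  apply GateProd.of_local (s := {p, q}) (by simp) (Finset.card_le_two) (cnot_mem hpq)
  apply exists_eq_embed
  · intro x y h i hi
    simp only [Finset.mem_insert, Finset.mem_singleton, not_or] at hi
    unfold SkewedLS.cnot at h
    split_ifs at h with h1
    · rw [h1, cnotMap, Function.update_of_ne hi.2]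
    · exact absurd rfl h
  · intro x y x' y' h h' hx hy
    unfold SkewedLS.cnot
    have : y = cnotMap p q x ↔ y' = cnotMap p q x' := by
      rw [funext_iff, funext_iff]
      refine forall_congr' fun i => ?_
      have hp := hx p (by simp)
      have hq := hx q (by simp)
      by_cases hiq : i = q
      · subst hiq
        simp [cnotMap, hp, hq, hy i (by simp)]
      · by_cases hip : i = p
        · subst hip
          simp [cnotMap, hpq, hp, hy i (by simp)]
        · have hi : i ∉ ({p, q} : Finset Q) := by simp [hiq, hip]
          simp [cnotMap, Function.update_of_ne hiq, h i hi, h' i hi]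
    simp only [this]

lemma GateProd.controlled_phase (o : Option Q) (f : Bool → ℂ) (hf : ∀ a, ‖f a‖ = 1) :
    GateProd 1 (Matrix.diagonal (fun x : Option Q → Bool =>
      if x none = true then f (x o) else 1)) := by
  apply GateProd.diagonal (s := {none, o}) (by simp) Finset.card_le_two
    (fun a => if a ⟨none, by simp⟩ = true then f (a ⟨o, by simp⟩) else 1)
  · intro a
    split_ifs
    · exact hf _
    · simp
  · intro x; rfl

/-- By `exists_phases` the diagonal consists of a phase of each bit and a phase of their parity. The
parity is written into `q` by a CNOT and removed by a second one, neither needing a control. This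
makes 1 + 1 + 3 gates. -/
lemma GateProd.controlled_diagonal {p q : Q} (hpq : p ≠ q) (z : Bool → Bool → ℂ)
    (hz : ∀ a b, ‖z a b‖ = 1) :
    GateProd 5 (controlled (Matrix.diagonal (fun x : Q → Bool => z (x p) (x q)))) := by
  obtain ⟨f, g, h, hf, hg, hh, hfgh⟩ := exists_phases z hz
  have hpq' : some p ≠ some q := fun h => hpq (Option.some.inj h)
  have h1 : controlled (Matrix.diagonal (fun x : Q → Bool => z (x p) (x q))) =
      (Matrix.diagonal (fun x : Option Q → Bool => if x none = true then f (x (some p)) else 1) *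
        Matrix.diagonal (fun x : Option Q → Bool =>
          if x none = true then g (x (some q)) else 1)) *
      (SkewedLS.cnot (some p) (some q) * Matrix.diagonal (fun x : Option Q → Bool =>
          if x none = true then h (x (some q)) else 1) * SkewedLS.cnot (some p) (some q)) := by
    rw [SkewedLS.controlled_diagonal, cnot_mul_diagonal_mul_cnot hpq',
      diagonal_mul_diagonal, diagonal_mul_diagonal]
    congr 1
    funext x
    have e1 : cnotMap (some p) (some q) x none = x none := by simp [cnotMap]
    have e2 : cnotMap (some p) (some q) x (some q) = xor (x (some p)) (x (some q)) := by
      simp [cnotMap]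
    rw [e1, e2]
    split_ifs
    · exact hfgh _ _
    · simp
  rw [h1]
  exact ((GateProd.controlled_phase _ f hf).mul (GateProd.controlled_phase _ g hg)).mul
    (((GateProd.cnot hpq').mul (GateProd.controlled_phase _ h hh)).mul (GateProd.cnot hpq'))

/-- A one-qubit gate becomes a single two-qubit gate. For a two-qubit gate W D W†, the control is
needed on D only, and 1 + 5 + 1 gates suffice. -/
lemma GateProd.controlled_gate (g : Gate Q) : GateProd 7 (controlled g.toMatrix) := by
  rw [Gate.toMatrix_eq_embed]
  have hpos := g.nonempty.card_pos
  have hle := g.card_le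
  rcases (show g.qubits.card = 1 ∨ g.qubits.card = 2 by omega) with hc | hc
  · refine (GateProd.of_local (s := insert none (g.qubits.map Function.Embedding.some)) (by simp)
      ?_ (controlled_mem g.toMatrix_mem) (exists_controlled_eq_embed _ _)).mono (by norm_num)
    refine (Finset.card_insert_le _ _).trans ?_
    rw [Finset.card_map, hc]
  · obtain ⟨W, hW, d, hd, hm⟩ := exists_diagonalization g.unitary
    have hWe : SkewedLS.embed g.qubits W ∈ unitaryGroup (Q → Bool) ℂ :=
      (embed_mem_unitaryGroup_iff _ _).2 hW
    obtain ⟨p, q, hpq, hs⟩ := Finset.card_eq_two.1 hc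
    have h1 : GateProd 1 (onSys (SkewedLS.embed g.qubits W)) := by
      refine GateProd.of_local (s := g.qubits.map Function.Embedding.some) (by simpa using g.nonempty)
        (by simpa using hle) (onSys_mem hWe) (exists_onSys_eq_embed _ _)
    have h2 : GateProd 5 (controlled (SkewedLS.embed g.qubits (Matrix.diagonal d))) := by
      rw [embed_diagonal]
      have := GateProd.controlled_diagonal hpq
        (fun a b => d (fun i : g.qubits => if (i : Q) = p then a else b)) (fun a b => hd _)
      convert this using 5 with x
      funext i
      have hi : (i : Q) ∈ ({p, q} : Finset Q) := hs ▸ i.2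
      rcases Finset.mem_insert.1 hi with h | h
      · simp [h]
      · rw [Finset.mem_singleton] at h
        simp [h, hpq.symm]
    rw [hm, ← embed_mul, ← embed_mul, embed_conjTranspose,
      controlled_conj (mem_unitaryGroup_iff.1 hWe)]
    exact ((h1.mul h2).mul h1.conjTranspose)

lemma GateProd.controlled_layer (L : Layer Q) :
    GateProd (7 * Fintype.card Q) (controlled L.toMatrix) := by
  have key : ∀ l : List (Gate Q), GateProd (7 * l.length)
      (controlled (l.map Gate.toMatrix).prod) := by
    intro l
    induction l with
    | nil => simpa [controlled_one] using GateProd.one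
    | cons g l ih =>
      rw [List.map_cons, List.prod_cons, controlled_mul]
      exact ((GateProd.controlled_gate g).mul ih).mono (by simp; omega)
  exact (key L.gates).mono (Nat.mul_le_mul_left _ L.length_gates_le)

lemma GateProd.controlled_circuit (C : Circuit Q) :
    GateProd (7 * Fintype.card Q * C.depth) (controlled C.toMatrix) := by
  obtain ⟨l⟩ := C
  induction l with
  | nil =>
    change GateProd _ (controlled 1)
    rw [controlled_one]
    exact GateProd.one.mono (Nat.zero_le _)
  | cons L l ih =>
    rw [Circuit.toMatrix_cons, controlled_mul]
    exact (ih.mul (GateProd.controlled_layer L)).mono (by simp [Circuit.depth]; ring_nf; rfl)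

lemma GateProd.onControl {h : Matrix Bool Bool ℂ} (hh : h ∈ unitaryGroup Bool ℂ) :
    GateProd 1 (onControl (Q := Q) h) := by
  have hu : SkewedLS.onControl (Q := Q) h ∈ unitaryGroup (Option Q → Bool) ℂ := by
    rw [mem_unitaryGroup_iff, star_eq_conjTranspose] at *
    rw [onControl_eq_blk, blk_conjTranspose, blk_mul, ← blk_one]
    congr 1
    funext a b
    have := congrFun (congrFun hh a) b
    rw [Matrix.mul_apply] at this
    simp only [conjTranspose_apply] at this
    simp only [conjTranspose_smul, conjTranspose_one, smul_mul_smul_comm, Matrix.mul_one]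
    rw [← Finset.sum_smul, this, Matrix.one_apply]
    split_ifs <;> simp
  apply GateProd.of_local (s := {none}) (by simp) (by simp) hu
  apply exists_eq_embed
  · intro x y hne o ho
    cases o with
    | none => simp at ho
    | some q =>
      unfold SkewedLS.onControl at hne
      split_ifs at hne with h1
      · exact h1 q
      · exact absurd rfl hne
  · intro x y x' y' h1 h2 hx hy
    unfold SkewedLS.onControl
    rw [if_pos (fun q => h1 (some q) (by simp)), if_pos (fun q => h2 (some q) (by simp)),
      hx none (by simp), hy none (by simp)]

lemma inv_sqrt_two_mul_self : (((Real.sqrt 2)⁻¹ : ℝ) : ℂ) * (((Real.sqrt 2)⁻¹ : ℝ) : ℂ) = 1 / 2 := by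
  rw [← Complex.ofReal_mul, ← mul_inv, Real.mul_self_sqrt (by norm_num)]
  norm_num

lemma hadamard_mem : hadamard ∈ unitaryGroup Bool ℂ := by
  rw [mem_unitaryGroup_iff, star_eq_conjTranspose]
  have h := inv_sqrt_two_mul_self
  ext a b
  rw [Matrix.mul_apply]
  simp only [conjTranspose_apply, Fintype.sum_bool, hadamard]
  cases a <;> cases b <;> simp at h ⊢ <;> linear_combination 2 * h

lemma phase_mem (im : Bool) : phase im ∈ unitaryGroup Bool ℂ := by
  rw [mem_unitaryGroup_iff, star_eq_conjTranspose, phase, diagonal_conjTranspose,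
    diagonal_mul_diagonal, ← Matrix.diagonal_one]
  congr 1
  funext a
  cases a <;> cases im <;> simp

/-- The Hadamard test of `|0⟩` and `U_j† U_k` is a circuit of depth `O((n + 1) (d + 1))`. -/
lemma exists_hadamardTest (U V : Circuit Q) {d : ℕ} (hU : U.depth ≤ d) (hV : V.depth ≤ d)
    (im : Bool) :
    ∃ T : Circuit (Option Q), IsHadamardTest T im (U.toMatrixᴴ * V.toMatrix) ∧
      T.depth ≤ 14 * ((Fintype.card Q + 1) * (d + 1)) := by
  have h1 : GateProd (7 * Fintype.card Q * U.depth) (controlled U.toMatrixᴴ) := by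
    rw [controlled_conjTranspose]
    exact (GateProd.controlled_circuit U).conjTranspose
  have h2 := ((((GateProd.onControl (Q := Q) hadamard_mem).mul
    (GateProd.onControl (phase_mem im))).mul (h1.mul (GateProd.controlled_circuit V))).mul
      (GateProd.onControl hadamard_mem))
  obtain ⟨T, hT, hT'⟩ := h2.exists_circuit
  refine ⟨T, ?_, hT.trans ?_⟩
  · rw [IsHadamardTest, hT', controlled_mul]
  -- The two controlled circuits contribute at most 7·|Q|·d gates each, the control qubit three
  -- further ones.
  · have e1 := Nat.mul_le_mul_left (7 * Fintype.card Q) hU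
    have e2 := Nat.mul_le_mul_left (7 * Fintype.card Q) hV
    nlinarith [Nat.zero_le (Fintype.card Q * d), Nat.zero_le (Fintype.card Q), Nat.zero_le d]

end ControlledGate

/-! ### The outcome of the Hadamard test -/

section Outcome

variable {Q : Type} [Fintype Q] [DecidableEq Q]

/-- The value `1` of the outcome `0` and the value `-1` of the outcome `1`. -/
def sgn (b : Bool) : ℝ := if b = false then 1 else -1

/-- The real or imaginary part. -/
def part (im : Bool) (w : ℂ) : ℝ := if im = true then w.im else w.re

/-- The factor that turns the real part into the real or imaginary part. -/
def phaseFactor (im : Bool) : ℂ := if im = true then -Complex.I else 1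

/-- The test interferes |0⟩ with U|0⟩: the two branches of the control are recombined with relative
sign `sgn b`, and the phase gate supplies the factor −i when the imaginary part is wanted. -/
lemma state_hadamardTest {T : Circuit (Option Q)} {im : Bool}
    {U : Matrix (Q → Bool) (Q → Bool) ℂ} (hT : IsHadamardTest T im U) (b : Bool) (z : Q → Bool) :
    T.state (fun o => o.elim b z) = 1 / 2 *
      ((1 : Matrix (Q → Bool) (Q → Bool) ℂ) z (zeroState Q)
        + sgn b * phaseFactor im * U z (zeroState Q)) := by
  have h2 := inv_sqrt_two_mul_self
  set r : ℂ := (((Real.sqrt 2)⁻¹ : ℝ) : ℂ) with hr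
  have hzero : zeroState (Option Q) = fun o => o.elim false (zeroState Q) := by
    funext o; cases o <;> rfl
  rw [Circuit.state, hT, hzero]
  simp only [onControl_eq_blk, controlled_eq_blk, blk_mul, blk]
  simp only [Fintype.sum_bool, Option.elim_none, Option.elim_some, phase]
  cases b <;> cases im <;>
    simp [hadamard, ← hr, Matrix.add_apply, Matrix.smul_apply, phaseFactor, sgn, smul_smul] <;>
    rw [← one_div, ← h2] <;> ring

lemma norm_sq_add (δ u w : ℂ) (hw : ‖w‖ = 1) :
    ‖1 / 2 * (δ + w * u)‖ ^ 2 = (‖δ‖ ^ 2 + ‖u‖ ^ 2 + 2 * (star δ * (w * u)).re) / 4 := by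
  have h : ‖δ + w * u‖ ^ 2 = ‖δ‖ ^ 2 + ‖u‖ ^ 2 + 2 * (star δ * (w * u)).re := by
    have h1 : ‖w * u‖ = ‖u‖ := by rw [norm_mul, hw, one_mul]
    rw [← h1, Complex.sq_norm, Complex.sq_norm, Complex.sq_norm, Complex.normSq_add]
    simp only [Complex.mul_re, Complex.conj_re, Complex.conj_im, RCLike.star_def]
    ring
  rw [norm_mul, mul_pow, h]
  norm_num
  ring

lemma sum_norm_sq_column {U : Matrix (Q → Bool) (Q → Bool) ℂ}
    (hU : U ∈ unitaryGroup (Q → Bool) ℂ) (y : Q → Bool) : ∑ z, ‖U z y‖ ^ 2 = 1 := by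
  have h := congrFun (congrFun (mem_unitaryGroup_iff'.1 hU) y) y
  rw [Matrix.mul_apply, one_apply_eq] at h
  have h2 : ((∑ z, ‖U z y‖ ^ 2 : ℝ) : ℂ) = 1 := by
    rw [← h]
    push_cast
    refine Finset.sum_congr rfl fun z _ => ?_
    rw [star_apply, RCLike.star_def, Complex.conj_mul']
  exact_mod_cast h2

lemma outcomeProb_hadamardTest {T : Circuit (Option Q)} {im : Bool}
    {U : Matrix (Q → Bool) (Q → Bool) ℂ} (hU : U ∈ unitaryGroup (Q → Bool) ℂ)
    (hT : IsHadamardTest T im U) (v : Bool) :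
    T.outcomeProb none v = (1 + sgn v * part im (U (zeroState Q) (zeroState Q))) / 2 := by
  have h1 : T.outcomeProb none v = ∑ z : Q → Bool, ‖T.state (fun o => o.elim v z)‖ ^ 2 := by
    have h := sum_option (Q := Q)
      (fun x => ((if x none = v then ‖T.state x‖ ^ 2 else 0 : ℝ) : ℂ))
    have h' : T.outcomeProb none v = ∑ b : Bool, ∑ z : Q → Bool,
        if b = v then ‖T.state (fun o => o.elim b z)‖ ^ 2 else 0 := by
      rw [Circuit.outcomeProb]
      exact_mod_cast h
    rw [h']
    cases v <;> simp
  rw [h1]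
  have hw : ‖(sgn v : ℂ) * phaseFactor im‖ = 1 := by
    cases v <;> cases im <;> simp [sgn, phaseFactor]
  simp_rw [state_hadamardTest hT, norm_sq_add _ _ _ hw]
  rw [← Finset.sum_div, Finset.sum_add_distrib, Finset.sum_add_distrib, sum_norm_sq_column hU,
    sum_norm_sq_column (one_mem _), ← Finset.mul_sum]
  have h3 : ∑ z, (star ((1 : Matrix (Q → Bool) (Q → Bool) ℂ) z (zeroState Q)) *
      (sgn v * phaseFactor im * U z (zeroState Q))).re
      = sgn v * part im (U (zeroState Q) (zeroState Q)) := by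
    rw [Finset.sum_eq_single (zeroState Q)]
    · cases im <;> simp [phaseFactor, part, mul_assoc]
    · intro z _ hz
      rw [one_apply_ne hz]
      simp
    · simp
  rw [h3]
  ring

lemma outcomeProb_nonneg (T : Circuit (Option Q)) (q : Option Q) (v : Bool) :
    0 ≤ T.outcomeProb q v := by
  refine Finset.sum_nonneg fun x _ => ?_
  split_ifs <;> positivity

lemma sgn_sum (p : ℝ) : (1 + sgn true * p) / 2 + (1 + sgn false * p) / 2 = 1 := by
  simp [sgn]; ring

lemma isProbabilityMeasure_outcomeLaw {T : Circuit (Option Q)} {im : Bool}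
    {U : Matrix (Q → Bool) (Q → Bool) ℂ} (hU : U ∈ unitaryGroup (Q → Bool) ℂ)
    (hT : IsHadamardTest T im U) :
    MeasureTheory.IsProbabilityMeasure (T.outcomeLaw none) := by
  constructor
  simp only [Circuit.outcomeLaw, Fintype.sum_bool, MeasureTheory.Measure.add_apply,
    MeasureTheory.Measure.smul_apply, MeasureTheory.measure_univ, smul_eq_mul, mul_one]
  rw [← ENNReal.ofReal_add (outcomeProb_nonneg _ _ _) (outcomeProb_nonneg _ _ _),
    outcomeProb_hadamardTest hU hT, outcomeProb_hadamardTest hU hT, sgn_sum, ENNReal.ofReal_one]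

/-- Read as a sign, the outcome is an unbiased estimate of the real or imaginary part. Concentration
is applied to these signs. -/
lemma integral_sgn_outcomeLaw {T : Circuit (Option Q)} {im : Bool}
    {U : Matrix (Q → Bool) (Q → Bool) ℂ} (hU : U ∈ unitaryGroup (Q → Bool) ℂ)
    (hT : IsHadamardTest T im U) :
    ∫ b, sgn b ∂(T.outcomeLaw none) = part im (U (zeroState Q) (zeroState Q)) := by
  rw [Circuit.outcomeLaw, MeasureTheory.integral_finsetSum_measure]
  · simp only [MeasureTheory.integral_smul_measure, MeasureTheory.integral_dirac,
      Fintype.sum_bool, ENNReal.toReal_ofReal (outcomeProb_nonneg _ _ _)]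
    rw [outcomeProb_hadamardTest hU hT, outcomeProb_hadamardTest hU hT]
    simp [sgn]
    ring
  · intro v _
    apply MeasureTheory.Integrable.smul_measure _ ENNReal.ofReal_ne_top
    exact MeasureTheory.integrable_dirac (by simp)

end Outcome

open scoped Matrix.Norms.L2Operator

/-! ### Euclidean and spectral norms -/

section Norms

variable {m n : Type} [Fintype m] [Fintype n] [DecidableEq n]

lemma specNorm_eq (A : Matrix m n ℂ) : specNorm A = ‖A‖ := rfl

lemma l2norm_nonneg (v : m → ℂ) : 0 ≤ l2norm v := norm_nonneg _

lemma l2norm_zero : l2norm (0 : m → ℂ) = 0 := by simp [l2norm]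

lemma l2norm_pos {v : m → ℂ} (h : v ≠ 0) : 0 < l2norm v := by
  unfold l2norm
  rw [norm_pos_iff]
  simpa using h

lemma l2norm_add_le (v w : m → ℂ) : l2norm (v + w) ≤ l2norm v + l2norm w := by
  unfold l2norm
  rw [WithLp.toLp_add]
  exact norm_add_le _ _

lemma l2norm_sub_le (v w : m → ℂ) : l2norm (v - w) ≤ l2norm v + l2norm w := by
  unfold l2norm
  rw [WithLp.toLp_sub]
  exact norm_sub_le _ _

lemma l2norm_smul (r : ℂ) (v : m → ℂ) : l2norm (r • v) = ‖r‖ * l2norm v := by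
  unfold l2norm
  rw [WithLp.toLp_smul, norm_smul]

lemma l2norm_neg (v : m → ℂ) : l2norm (-v) = l2norm v := by
  unfold l2norm
  rw [WithLp.toLp_neg, norm_neg]

lemma l2norm_sq (v : m → ℂ) : l2norm v ^ 2 = ∑ i, ‖v i‖ ^ 2 := by
  unfold l2norm
  rw [EuclideanSpace.norm_sq_eq]

lemma l2norm_mulVec_le (A : Matrix m n ℂ) (v : n → ℂ) : l2norm (A *ᵥ v) ≤ ‖A‖ * l2norm v :=
  Matrix.l2_opNorm_mulVec A (WithLp.toLp 2 v)

lemma l2norm_add_sq (v w : m → ℂ) :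
    l2norm (v + w) ^ 2 = l2norm v ^ 2 + 2 * (star v ⬝ᵥ w).re + l2norm w ^ 2 := by
  simp only [l2norm_sq, dotProduct, Complex.re_sum, Finset.mul_sum, ← Finset.sum_add_distrib]
  refine Finset.sum_congr rfl fun i _ => ?_
  simp only [Pi.add_apply, Pi.star_apply, Complex.sq_norm, Complex.normSq_add, Complex.mul_re,
    RCLike.star_def, Complex.conj_re, Complex.conj_im]
  ring

lemma star_dotProduct_self_re (v : m → ℂ) : (star v ⬝ᵥ v).re = l2norm v ^ 2 := by
  simp only [l2norm_sq, dotProduct, Complex.re_sum]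
  refine Finset.sum_congr rfl fun i _ => ?_
  simp only [Pi.star_apply, RCLike.star_def, Complex.sq_norm, Complex.normSq_apply, Complex.mul_re,
    Complex.conj_re, Complex.conj_im]
  ring

end Norms

/-! ### The Moore-Penrose equations -/

section Penrose

variable {m n : Type} [Fintype m] [Fintype n] [DecidableEq n] (A : Matrix m n ℂ)

lemma exists_pinv_decomposition :
    ∃ (W : Matrix n n ℂ) (d : n → ℂ), W * Wᴴ = 1 ∧ Wᴴ * W = 1 ∧ (∀ i, star (d i) = d i) ∧
      Aᴴ * A = W * diagonal d * Wᴴ ∧ pinv A = W * diagonal (fun i => (d i)⁻¹) * Wᴴ * Aᴴ := by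
  set h := Matrix.isHermitian_conjTranspose_mul_self A with hh
  refine ⟨h.eigenvectorUnitary, fun i => ((h.eigenvalues i : ℝ) : ℂ),
    mem_unitaryGroup_iff.1 h.eigenvectorUnitary.2, mem_unitaryGroup_iff'.1 h.eigenvectorUnitary.2,
    fun i => Complex.conj_ofReal _, ?_, ?_⟩
  · have := h.spectral_theorem
    rw [Unitary.conjStarAlgAut_apply] at this
    exact this
  · unfold pinv
    simp only [Complex.ofReal_inv]

lemma pinv_mul_self_decomposition :
    ∃ (W : Matrix n n ℂ) (d : n → ℂ), W * Wᴴ = 1 ∧ Wᴴ * W = 1 ∧ (∀ i, star (d i) = d i) ∧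
      Aᴴ * A = W * diagonal d * Wᴴ ∧ pinv A = W * diagonal (fun i => (d i)⁻¹) * Wᴴ * Aᴴ ∧
      pinv A * A = W * diagonal (fun i => (d i)⁻¹ * d i) * Wᴴ := by
  obtain ⟨W, d, h1, h2, h3, h4, h5⟩ := exists_pinv_decomposition A
  refine ⟨W, d, h1, h2, h3, h4, h5, ?_⟩
  rw [h5, Matrix.mul_assoc, h4]
  calc W * diagonal (fun i => (d i)⁻¹) * Wᴴ * (W * diagonal d * Wᴴ)
      = W * diagonal (fun i => (d i)⁻¹) * (Wᴴ * W) * diagonal d * Wᴴ := by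
        simp only [Matrix.mul_assoc]
    _ = W * (diagonal (fun i => (d i)⁻¹) * diagonal d) * Wᴴ := by
        rw [h2, Matrix.mul_one]; simp only [Matrix.mul_assoc]
    _ = _ := by rw [diagonal_mul_diagonal]

lemma isHermitian_pinv_mul : (pinv A * A)ᴴ = pinv A * A := by
  obtain ⟨W, d, h1, h2, h3, h4, h5, h6⟩ := pinv_mul_self_decomposition A
  rw [h6, conjTranspose_mul, conjTranspose_mul, conjTranspose_conjTranspose,
    diagonal_conjTranspose, Matrix.mul_assoc]
  congr 3
  funext i
  simp [h3, -RCLike.star_def]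

lemma isHermitian_mul_pinv : (A * pinv A)ᴴ = A * pinv A := by
  obtain ⟨W, d, h1, h2, h3, h4, h5, h6⟩ := pinv_mul_self_decomposition A
  have : (diagonal fun i => (d i)⁻¹)ᴴ = diagonal fun i => (d i)⁻¹ := by
    rw [diagonal_conjTranspose]
    congr 1
    funext i
    simp [h3, -RCLike.star_def]
  rw [h5]
  simp only [conjTranspose_mul, conjTranspose_conjTranspose, this, Matrix.mul_assoc]

lemma pinv_mul_pinv : pinv A * A * pinv A = pinv A := by
  obtain ⟨W, d, h1, h2, h3, h4, h5, h6⟩ := pinv_mul_self_decomposition A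
  rw [h6]
  conv_lhs => rw [h5]
  calc W * diagonal (fun i => (d i)⁻¹ * d i) * Wᴴ * (W * diagonal (fun i => (d i)⁻¹) * Wᴴ * Aᴴ)
      = W * diagonal (fun i => (d i)⁻¹ * d i) * (Wᴴ * W) * diagonal (fun i => (d i)⁻¹) * Wᴴ * Aᴴ := by
        simp only [Matrix.mul_assoc]
    _ = W * (diagonal (fun i => (d i)⁻¹ * d i) * diagonal (fun i => (d i)⁻¹)) * Wᴴ * Aᴴ := by
        rw [h2, Matrix.mul_one]; simp only [Matrix.mul_assoc]
    _ = _ := by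
        rw [diagonal_mul_diagonal, h5]
        congr 4
        funext i
        by_cases h : d i = 0
        · simp [h]
        · field_simp

-- The decomposition gives A†A(A⁺A − 1) = 0, and B†B = 0 forces B = 0, applied to B = A(A⁺A − 1).
open scoped ComplexOrder in
lemma mul_pinv_mul : A * pinv A * A = A := by
  obtain ⟨W, d, h1, h2, h3, h4, h5, h6⟩ := pinv_mul_self_decomposition A
  have h7 : Aᴴ * A * (pinv A * A) = Aᴴ * A := by
    rw [h6, h4]
    calc W * diagonal d * Wᴴ * (W * diagonal (fun i => (d i)⁻¹ * d i) * Wᴴ)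
        = W * diagonal d * (Wᴴ * W) * diagonal (fun i => (d i)⁻¹ * d i) * Wᴴ := by
          simp only [Matrix.mul_assoc]
      _ = W * (diagonal d * diagonal (fun i => (d i)⁻¹ * d i)) * Wᴴ := by
          rw [h2, Matrix.mul_one]; simp only [Matrix.mul_assoc]
      _ = _ := by
          rw [diagonal_mul_diagonal]
          congr 3
          funext i
          by_cases h : d i = 0
          · simp [h]
          · field_simp
  have h8 : A * (pinv A * A - 1) = 0 := by
    rw [← conjTranspose_mul_self_eq_zero, conjTranspose_mul, Matrix.mul_assoc,
      ← Matrix.mul_assoc Aᴴ, Matrix.mul_sub (Aᴴ * A), h7, Matrix.mul_one, sub_self,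
      Matrix.mul_zero]
  rw [Matrix.mul_sub, Matrix.mul_one, sub_eq_zero] at h8
  rw [Matrix.mul_assoc, h8]

lemma pinv_ne_zero (hA : A ≠ 0) : pinv A ≠ 0 := by
  intro h
  apply hA
  rw [← mul_pinv_mul A, h]
  simp

lemma one_le_norm_mul_norm_pinv [DecidableEq m] (hA : A ≠ 0) : 1 ≤ ‖A‖ * ‖pinv A‖ := by
  have h1 : 0 < ‖A‖ := norm_pos_iff.2 hA
  have h2 : ‖A‖ ≤ ‖A‖ * ‖pinv A‖ * ‖A‖ := by
    calc ‖A‖ = ‖A * pinv A * A‖ := by rw [mul_pinv_mul]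
      _ ≤ ‖A * pinv A‖ * ‖A‖ := Matrix.l2_opNorm_mul _ _
      _ ≤ ‖A‖ * ‖pinv A‖ * ‖A‖ := by
        gcongr
        exact Matrix.l2_opNorm_mul _ _
  by_contra h
  push Not at h
  nlinarith

/-- For `V = A† A`, the product `V A⁺ (A⁺)†` is the orthogonal projection onto the range of `A†`. -/
lemma gram_mul_pinv [DecidableEq m] :
    Aᴴ * A * (pinv A * (pinv A)ᴴ) = pinv A * A := by
  calc Aᴴ * A * (pinv A * (pinv A)ᴴ) = Aᴴ * (A * pinv A) * (pinv A)ᴴ := by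
        simp only [Matrix.mul_assoc]
    _ = (pinv A * (A * pinv A) * A)ᴴ := by
        rw [conjTranspose_mul, conjTranspose_mul (pinv A), isHermitian_mul_pinv A,
          Matrix.mul_assoc Aᴴ]
    _ = pinv A * A := by
        rw [← Matrix.mul_assoc, pinv_mul_pinv, isHermitian_pinv_mul]

/-- The C*-identity reads ‖R‖ = ‖R‖² for an orthogonal projection. -/
lemma norm_le_one_of_projection {R : Matrix n n ℂ} (h1 : Rᴴ = R) (h2 : R * R = R) : ‖R‖ ≤ 1 := by
  have h := Matrix.l2_opNorm_conjTranspose_mul_self R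
  rw [h1, h2] at h
  by_contra h3
  push Not at h3
  nlinarith

/-- The adjoint of a Penrose equation. It yields Vc = V²α*, which expresses α_λ through α* below. -/
lemma hermitian_mul_mul_pinv {V : Matrix n n ℂ} (hV : Vᴴ = V) : V * (V * pinv V) = V := by
  have h := congrArg conjTranspose (mul_pinv_mul V)
  rwa [conjTranspose_mul, isHermitian_mul_pinv, hV] at h

end Penrose

/-! ### Perturbation of the shifted system -/

section Perturbation

variable {ι : Type} [Fintype ι] [DecidableEq ι]

/-- The cross term is 2r⟨V²v, v⟩ = 2r‖Vv‖², nonnegative for r ≥ 0. Dropping terms gives the two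
lower bounds that follow, ‖(V² + r)v‖ ≥ r‖v‖ and ≥ ‖V²v‖, which replace a functional calculus. -/
lemma l2norm_shifted_sq {V : Matrix ι ι ℂ} (hV : Vᴴ = V) (r : ℝ) (v : ι → ℂ) :
    l2norm ((V ^ 2 + (r : ℂ) • 1) *ᵥ v) ^ 2 =
      l2norm ((V ^ 2) *ᵥ v) ^ 2 + 2 * r * l2norm (V *ᵥ v) ^ 2 + r ^ 2 * l2norm v ^ 2 := by
  rw [add_mulVec, l2norm_add_sq, smul_mulVec, one_mulVec, l2norm_smul, dotProduct_smul]
  have h1 : (star ((V ^ 2) *ᵥ v) ⬝ᵥ v) = star (V *ᵥ v) ⬝ᵥ (V *ᵥ v) := by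
    rw [pow_two, ← mulVec_mulVec, star_mulVec, ← dotProduct_mulVec, hV]
  rw [h1, smul_eq_mul, Complex.re_ofReal_mul, star_dotProduct_self_re, mul_pow]
  simp
  ring

lemma shifted_lower {V : Matrix ι ι ℂ} (hV : Vᴴ = V) {r : ℝ} (hr : 0 ≤ r) (v : ι → ℂ) :
    r * l2norm v ≤ l2norm ((V ^ 2 + (r : ℂ) • 1) *ᵥ v) := by
  have h := l2norm_shifted_sq hV r v
  refine abs_le_of_sq_le_sq' ?_ (l2norm_nonneg _) |>.2
  rw [h, mul_pow]
  have := mul_nonneg hr (sq_nonneg (l2norm (V *ᵥ v)))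
  nlinarith [sq_nonneg (l2norm ((V ^ 2) *ᵥ v))]

lemma sq_le_shifted {V : Matrix ι ι ℂ} (hV : Vᴴ = V) {r : ℝ} (hr : 0 ≤ r) (v : ι → ℂ) :
    l2norm ((V ^ 2) *ᵥ v) ≤ l2norm ((V ^ 2 + (r : ℂ) • 1) *ᵥ v) := by
  have h := l2norm_shifted_sq hV r v
  refine abs_le_of_sq_le_sq' ?_ (l2norm_nonneg _) |>.2
  rw [h]
  have := mul_nonneg hr (sq_nonneg (l2norm (V *ᵥ v)))
  nlinarith [mul_nonneg (sq_nonneg r) (sq_nonneg (l2norm v))]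

lemma isUnit_det_of_lower {X : Matrix ι ι ℂ} {r : ℝ} (hr : 0 < r)
    (h : ∀ v, r * l2norm v ≤ l2norm (X *ᵥ v)) : IsUnit X.det := by
  rw [isUnit_iff_ne_zero]
  intro h0
  obtain ⟨v, hv, hv'⟩ := exists_mulVec_eq_zero_iff.2 h0
  have := h v
  rw [hv', l2norm_zero] at this
  nlinarith [l2norm_pos hv]

lemma mulVec_inv_cancel {X : Matrix ι ι ℂ} (h : IsUnit X.det) (v : ι → ℂ) :
    X *ᵥ (X⁻¹ *ᵥ v) = v := by
  rw [mulVec_mulVec, mul_nonsing_inv _ h, one_mulVec]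

lemma inv_mulVec_eq {X : Matrix ι ι ℂ} (h : IsUnit X.det) {v w : ι → ℂ} (hw : X *ᵥ w = v) :
    X⁻¹ *ᵥ v = w := by
  rw [← hw, mulVec_mulVec, nonsing_inv_mul _ h, one_mulVec]

/-- The perturbed shifted system is nonsingular, and its solution is close to that of the
unperturbed one. -/
lemma perturbed_solution {V Vh : Matrix ι ι ℂ} (hV : Vᴴ = V) {c α : ι → ℂ}
    (hα : V *ᵥ c = (V ^ 2) *ᵥ α) {b lam η ε : ℝ} (hb : ‖V‖ ≤ b) (hlam : 0 < lam) (hε : 0 < ε)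
    (hη : 0 ≤ η) (hE : ‖Vh - V‖ ≤ η) (hηb : η ≤ 19 * b)
    (hkey : b * η * (b * l2norm α + ε + l2norm c) ≤ lam * ε / 84) :
    IsUnit (Vh ^ 2 + (lam : ℂ) • 1).det ∧
      l2norm (V *ᵥ ((Vh ^ 2 + (lam : ℂ) • 1)⁻¹ *ᵥ (Vh *ᵥ c)
        - (V ^ 2 + (lam : ℂ) • 1)⁻¹ *ᵥ (V *ᵥ c))) ≤ ε / 2 := by
  set Q := V ^ 2 + (lam : ℂ) • (1 : Matrix ι ι ℂ) with hQ
  set Qh := Vh ^ 2 + (lam : ℂ) • (1 : Matrix ι ι ℂ) with hQh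
  set E := Vh - V with hEdef
  have hb0 : 0 ≤ b := (norm_nonneg V).trans hb
  have hα0 := l2norm_nonneg α
  have hc0 := l2norm_nonneg c
  have hQunit : IsUnit Q.det := isUnit_det_of_lower hlam (shifted_lower hV hlam.le)
  -- The constant is 1 + 1 + 19, from VE, EV and E², the last one estimated with η ≤ 19b.
  have hD : ‖Qh - Q‖ ≤ 21 * (b * η) := by
    have h1 : Qh - Q = V * E + E * V + E * E := by
      rw [hQh, hQ, hEdef]
      noncomm_ring
    rw [h1]
    calc ‖V * E + E * V + E * E‖ ≤ ‖V * E‖ + ‖E * V‖ + ‖E * E‖ := norm_add₃_le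
      _ ≤ ‖V‖ * ‖E‖ + ‖E‖ * ‖V‖ + ‖E‖ * ‖E‖ := by
          gcongr <;> exact Matrix.l2_opNorm_mul _ _
      _ ≤ b * η + η * b + η * (19 * b) := by
          have := norm_nonneg E
          gcongr
          exact hE.trans hηb
      _ = 21 * (b * η) := by ring
  have hbη0 : 0 ≤ b * η := mul_nonneg hb0 hη
  -- The summand ε in `hkey` serves this bound. It makes ‖Q̂ − Q‖ at most λ/4, so Q̂ stays bounded
  -- below by λ/2. `Vh` is not assumed Hermitian, and the lower bound has to come from Q.
  have hbη : b * η ≤ lam / 84 := by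
    have : b * η * ε ≤ lam * ε / 84 := by
      refine le_trans ?_ hkey
      apply mul_le_mul_of_nonneg_left _ hbη0
      nlinarith [mul_nonneg hb0 hα0]
    nlinarith
  have hlow : ∀ v, lam / 2 * l2norm v ≤ l2norm (Qh *ᵥ v) := by
    intro v
    have h1 := shifted_lower hV hlam.le v
    have h2 : Q *ᵥ v = Qh *ᵥ v - (Qh - Q) *ᵥ v := by rw [sub_mulVec]; abel
    have h3 := l2norm_sub_le (Qh *ᵥ v) ((Qh - Q) *ᵥ v)
    rw [← h2] at h3
    have h4 := l2norm_mulVec_le (Qh - Q) v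
    have h5 : ‖Qh - Q‖ * l2norm v ≤ lam / 2 * l2norm v := by
      apply mul_le_mul_of_nonneg_right _ (l2norm_nonneg v)
      linarith
    linarith
  have hQhunit : IsUnit Qh.det := isUnit_det_of_lower (by linarith) hlow
  refine ⟨hQhunit, ?_⟩
  set αl := Q⁻¹ *ᵥ (V *ᵥ c) with hαl
  -- As Vc = V²α, the shifted solution is V²Q⁻¹α; since V²Q⁻¹ is a contraction, it is no longer than
  -- α.
  have hαl' : αl = (V ^ 2) *ᵥ (Q⁻¹ *ᵥ α) := by
    apply inv_mulVec_eq hQunit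
    rw [hα, mulVec_mulVec]
    have : Q * V ^ 2 = V ^ 2 * Q := by rw [hQ]; noncomm_ring
    rw [this, ← mulVec_mulVec, mulVec_inv_cancel hQunit]
  have hαle : l2norm αl ≤ l2norm α := by
    rw [hαl']
    refine (sq_le_shifted hV hlam.le _).trans ?_
    rw [← hQ, mulVec_inv_cancel hQunit]
  set αh := Qh⁻¹ *ᵥ (Vh *ᵥ c) with hαh
  have hdiff : Qh *ᵥ (αh - αl) = E *ᵥ c - (Qh - Q) *ᵥ αl := by
    have h0 : Q *ᵥ αl = V *ᵥ c := mulVec_inv_cancel hQunit _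
    rw [mulVec_sub, sub_mulVec Qh, h0, hαh, mulVec_inv_cancel hQhunit, hEdef, sub_mulVec]
    abel
  have h1 := hlow (αh - αl)
  rw [hdiff] at h1
  have h2 := l2norm_sub_le (E *ᵥ c) ((Qh - Q) *ᵥ αl)
  have h3 : l2norm (E *ᵥ c) ≤ η * l2norm c :=
    (l2norm_mulVec_le _ _).trans (mul_le_mul_of_nonneg_right hE hc0)
  have h4 : l2norm ((Qh - Q) *ᵥ αl) ≤ 21 * (b * η) * l2norm α :=
    (l2norm_mulVec_le _ _).trans (mul_le_mul hD hαle (l2norm_nonneg _) (by positivity))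
  have h5 : l2norm (V *ᵥ (αh - αl)) ≤ b * l2norm (αh - αl) :=
    (l2norm_mulVec_le _ _).trans (mul_le_mul_of_nonneg_right hb (l2norm_nonneg _))
  have h6 : lam / 2 * (b * l2norm (αh - αl)) ≤ lam / 2 * (ε / 2) := by
    calc lam / 2 * (b * l2norm (αh - αl)) = b * (lam / 2 * l2norm (αh - αl)) := by ring
      _ ≤ b * (η * l2norm c + 21 * (b * η) * l2norm α) := by
          apply mul_le_mul_of_nonneg_left _ hb0
          linarith
      _ ≤ 21 * (b * η * (b * l2norm α + ε + l2norm c)) := by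
          nlinarith [mul_nonneg hbη0 hc0, mul_nonneg hbη0 hε.le]
      _ ≤ 21 * (lam * ε / 84) := by linarith
      _ = lam / 2 * (ε / 2) := by ring
  exact h5.trans (le_of_mul_le_mul_left h6 (by linarith))

variable {m : Type} [Fintype m] [DecidableEq m]

/-- Multiplication by Q turns the difference into V²c − (V² + λ)Pc = −λPc. Writing P = V²B² with B =
A⁺(A⁺)† produces a factor V²Q⁻¹, a contraction, instead of Q⁻¹, whose bound 1/λ would cancel the
gain. -/
lemma shifted_bias (A : Matrix m ι ℂ) (c : ι → ℂ) {lam : ℝ} (hlam : 0 < lam) :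
    l2norm ((Aᴴ * A) *ᵥ (((Aᴴ * A) ^ 2 + (lam : ℂ) • 1)⁻¹ *ᵥ ((Aᴴ * A) *ᵥ c))
      - (pinv A * A) *ᵥ c) ≤ lam * ‖pinv A‖ ^ 4 * l2norm c := by
  set V := Aᴴ * A with hVdef
  have hV : Vᴴ = V := isHermitian_conjTranspose_mul_self A
  set Q := V ^ 2 + (lam : ℂ) • (1 : Matrix ι ι ℂ) with hQ
  set P := pinv A * A with hP
  set B := pinv A * (pinv A)ᴴ with hB
  have hQunit : IsUnit Q.det := isUnit_det_of_lower hlam (shifted_lower hV hlam.le)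
  have hVB : V * B = P := gram_mul_pinv A
  have hVP : V * P = V := by
    rw [hVdef, hP, Matrix.mul_assoc, ← Matrix.mul_assoc A, mul_pinv_mul]
  have hVVBB : V ^ 2 * (B * B) = P := by
    calc V ^ 2 * (B * B) = V * (V * B) * B := by noncomm_ring
      _ = P := by rw [hVB, hVP, hVB]
  have hcomm : Q * V = V * Q := by rw [hQ]; noncomm_ring
  have hcomm2 : Q * V ^ 2 = V ^ 2 * Q := by rw [hQ]; noncomm_ring
  clear_value V
  set w := (B * B) *ᵥ c with hw
  have hβ : V *ᵥ (Q⁻¹ *ᵥ (V *ᵥ c)) - P *ᵥ c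
      = -((lam : ℂ) • ((V ^ 2) *ᵥ (Q⁻¹ *ᵥ w))) := by
    have h1 : Q *ᵥ (V *ᵥ (Q⁻¹ *ᵥ (V *ᵥ c)) - P *ᵥ c)
        = Q *ᵥ (-((lam : ℂ) • ((V ^ 2) *ᵥ (Q⁻¹ *ᵥ w)))) := by
      rw [mulVec_sub, mulVec_mulVec _ Q V, hcomm, ← mulVec_mulVec _ V Q, mulVec_inv_cancel hQunit,
        mulVec_neg, mulVec_smul, mulVec_mulVec _ Q (V ^ 2), hcomm2,
        ← mulVec_mulVec _ (V ^ 2) Q,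
        mulVec_inv_cancel hQunit, hw, mulVec_mulVec, mulVec_mulVec, mulVec_mulVec, hVVBB,
        ← smul_mulVec, ← neg_mulVec, ← sub_mulVec]
      congr 1
      rw [hQ, Matrix.add_mul, pow_two, Matrix.mul_assoc V V P, hVP, smul_mul_assoc, Matrix.one_mul]
      abel
    have h2 := congrArg (fun v => Q⁻¹ *ᵥ v) h1
    simpa only [mulVec_mulVec _ Q⁻¹ Q, nonsing_inv_mul _ hQunit, one_mulVec] using h2
  rw [hβ, l2norm_neg, l2norm_smul]
  have hlam' : ‖(lam : ℂ)‖ = lam := by simp [abs_of_pos hlam]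
  rw [hlam', mul_assoc]
  apply mul_le_mul_of_nonneg_left _ hlam.le
  refine (sq_le_shifted hV hlam.le _).trans ?_
  rw [← hQ, mulVec_inv_cancel hQunit]
  refine (l2norm_mulVec_le _ _).trans ?_
  apply mul_le_mul_of_nonneg_right _ (l2norm_nonneg c)
  have hBn : ‖B‖ ≤ ‖pinv A‖ ^ 2 := by
    refine (Matrix.l2_opNorm_mul _ _).trans ?_
    rw [Matrix.l2_opNorm_conjTranspose, pow_two]
  calc ‖B * B‖ ≤ ‖B‖ * ‖B‖ := Matrix.l2_opNorm_mul _ _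
    _ ≤ ‖pinv A‖ ^ 2 * ‖pinv A‖ ^ 2 := by gcongr
    _ = ‖pinv A‖ ^ 4 := by ring

/-- For every z, Pc − c is the image of A†z − c under the contraction 1 − P, because P fixes the
range of A†. -/
lemma residual_lower (A : Matrix m ι ℂ) (c : ι → ℂ) :
    l2norm ((pinv A * A) *ᵥ c - c) ≤ ⨅ z : m → ℂ, l2norm (Aᴴ *ᵥ z - c) := by
  apply le_ciInf
  intro z
  set P := pinv A * A with hP
  have hPP : P * P = P := by rw [hP, ← Matrix.mul_assoc, pinv_mul_pinv]
  have hPA : P * Aᴴ = Aᴴ := by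
    have h := congrArg conjTranspose (mul_pinv_mul A)
    rwa [Matrix.mul_assoc, conjTranspose_mul, isHermitian_pinv_mul] at h
  have h1 : P *ᵥ c - c = (1 - P) *ᵥ (Aᴴ *ᵥ z - c) := by
    rw [mulVec_sub, mulVec_mulVec, Matrix.sub_mul, hPA, Matrix.one_mul, sub_self, zero_mulVec,
      sub_mulVec, one_mulVec]
    abel
  have h2 : ‖1 - P‖ ≤ 1 := by
    apply norm_le_one_of_projection
    · rw [conjTranspose_sub, conjTranspose_one, isHermitian_pinv_mul]
    · rw [Matrix.sub_mul, Matrix.mul_sub, Matrix.mul_sub, hPP]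
      simp
  rw [h1]
  refine (l2norm_mulVec_le _ _).trans ?_
  have := l2norm_nonneg (Aᴴ *ᵥ z - c)
  nlinarith

/-- If the estimate `Vh` of `A† A` is accurate enough, the algorithm succeeds. -/
theorem approximate_solution {M : ℕ} (A : Matrix m (Fin M) ℂ) (hA : A ≠ 0) (c : Fin M → ℂ)
    (hc : c ≠ 0) {ε η : ℝ} (hε : 0 < ε) (hη : 0 ≤ η) (Vh : Matrix (Fin M) (Fin M) ℂ)
    (hE : ‖Vh - Aᴴ * A‖ ≤ η) (hη1 : η ≤ 19 * specNorm A ^ 2)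
    (hη2 : η ^ 2 * mainFactor A c ε ≤ (1 / 168) ^ 2) :
    IsUnit (Vh ^ 2 + (shift A c ε : ℂ) • 1).det ∧
      IsApproxSolution A c ε
        (A *ᵥ ((Vh ^ 2 + (shift A c ε : ℂ) • 1)⁻¹ *ᵥ (Vh *ᵥ c))) := by
  have ha : 0 < ‖A‖ := norm_pos_iff.2 hA
  have hx : 0 < ‖pinv A‖ := norm_pos_iff.2 (pinv_ne_zero A hA)
  have hcn := l2norm_pos hc
  have hax := one_le_norm_mul_norm_pinv A hA
  have hlam : 0 < shift A c ε := by
    unfold shift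
    rw [specNorm_eq, specNorm_eq]
    positivity
  have hlam_eq : shift A c ε * (2 * ‖pinv A‖ ^ 8 * ‖A‖ ^ 4 * l2norm c) = ε := by
    unfold shift
    rw [specNorm_eq, specNorm_eq]
    field_simp
  have hV : (Aᴴ * A)ᴴ = Aᴴ * A := isHermitian_conjTranspose_mul_self A
  have hα : (Aᴴ * A) *ᵥ c = ((Aᴴ * A) ^ 2) *ᵥ alphaStar A c := by
    rw [alphaStar, mulVec_mulVec, pow_two, Matrix.mul_assoc, hermitian_mul_mul_pinv hV]
  have hVn : ‖Aᴴ * A‖ ≤ ‖A‖ ^ 2 := by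
    rw [Matrix.l2_opNorm_conjTranspose_mul_self, pow_two]
  rw [specNorm_eq] at hη1
  set lam := shift A c ε with hlamdef
  set s := ‖A‖ ^ 2 * l2norm (alphaStar A c) + ε + l2norm c with hs
  have hs0 : 0 < s := by
    have := l2norm_nonneg (alphaStar A c)
    positivity
  -- Inserting λ, the claim becomes η‖A‖⁶‖A⁺‖⁸‖c‖s/ε² ≤ 1/168, with 168 = 2·84. The square of the
  -- factor of η is exactly `mainFactor`.
  have hkey : ‖A‖ ^ 2 * η * s ≤ lam * ε / 84 := by
    have h1 : η ^ 2 * mainFactor A c ε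
        = (η * (‖A‖ ^ 6 * ‖pinv A‖ ^ 8 * l2norm c * s / ε ^ 2)) ^ 2 := by
      unfold mainFactor cond
      rw [specNorm_eq, specNorm_eq, ← hs]
      field_simp
    rw [h1] at hη2
    have h2 := abs_le_of_sq_le_sq' hη2 (by norm_num) |>.2
    rw [mul_div_assoc', div_le_iff₀ (by positivity)] at h2
    have h3 : (‖A‖ ^ 2 * η * s) * (‖pinv A‖ ^ 8 * ‖A‖ ^ 4 * l2norm c)
        ≤ (lam * ε / 84) * (‖pinv A‖ ^ 8 * ‖A‖ ^ 4 * l2norm c) := by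
      calc (‖A‖ ^ 2 * η * s) * (‖pinv A‖ ^ 8 * ‖A‖ ^ 4 * l2norm c)
          = η * (‖A‖ ^ 6 * ‖pinv A‖ ^ 8 * l2norm c * s) := by ring
        _ ≤ 1 / 168 * ε ^ 2 := h2
        _ = 1 / 168 * ε * (lam * (2 * ‖pinv A‖ ^ 8 * ‖A‖ ^ 4 * l2norm c)) := by
            rw [hlam_eq]; ring
        _ = _ := by ring
    exact le_of_mul_le_mul_right h3 (by positivity)
  obtain ⟨h1, h2⟩ := perturbed_solution hV hα hVn hlam hε hη hE hη1 hkey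
  refine ⟨h1, ?_⟩
  have h3 := shifted_bias A c hlam
  have h4 := residual_lower A c
  -- By the choice of λ, the left side times κ⁴ equals ε/2, and κ ≥ 1.
  have h5 : lam * ‖pinv A‖ ^ 4 * l2norm c ≤ ε / 2 := by
    have h6 : (lam * ‖pinv A‖ ^ 4 * l2norm c) * (‖A‖ * ‖pinv A‖) ^ 4 = ε / 2 := by
      rw [← hlam_eq]; ring
    rw [← h6]
    exact le_mul_of_one_le_right (by positivity) (one_le_pow₀ hax)
  unfold IsApproxSolution
  set αh := (Vh ^ 2 + (lam : ℂ) • (1 : Matrix (Fin M) (Fin M) ℂ))⁻¹ *ᵥ (Vh *ᵥ c) with hαh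
  set αl := ((Aᴴ * A) ^ 2 + (lam : ℂ) • (1 : Matrix (Fin M) (Fin M) ℂ))⁻¹ *ᵥ ((Aᴴ * A) *ᵥ c)
  have h7 : Aᴴ *ᵥ (A *ᵥ αh) - c = (Aᴴ * A) *ᵥ (αh - αl)
      + ((Aᴴ * A) *ᵥ αl - (pinv A * A) *ᵥ c) + ((pinv A * A) *ᵥ c - c) := by
    rw [mulVec_mulVec, mulVec_sub]
    abel
  rw [h7]
  have h8 := l2norm_add_le ((Aᴴ * A) *ᵥ (αh - αl) + ((Aᴴ * A) *ᵥ αl - (pinv A * A) *ᵥ c))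
    ((pinv A * A) *ᵥ c - c)
  have h9 := l2norm_add_le ((Aᴴ * A) *ᵥ (αh - αl)) ((Aᴴ * A) *ᵥ αl - (pinv A * A) *ᵥ c)
  linarith

lemma pinv_mul_self_of_linearIndependent (A : Matrix m ι ℂ) (h : LinearIndependent ℂ Aᵀ) :
    pinv A * A = 1 := by
  have hinj : Function.Injective A.mulVec := mulVec_injective_iff.2 h
  apply Matrix.ext_of_mulVec_single
  intro j
  apply hinj
  rw [one_mulVec, mulVec_mulVec, ← Matrix.mul_assoc, mul_pinv_mul]

end Perturbation

/-! ### Nets and operator norms -/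

section Nets

/-- A 1-separated subset of the ball of radius 2 has at most 5^dim points. One of maximal size is
1-dense in that ball, and halving it gives the net. -/
lemma exists_net (E : Type) [NormedAddCommGroup E] [NormedSpace ℝ E] [FiniteDimensional ℝ E] :
    ∃ N : Finset E, N.card ≤ 5 ^ Module.finrank ℝ E ∧ (∀ x ∈ N, ‖x‖ ≤ 1) ∧
      ∀ x : E, ‖x‖ ≤ 1 → ∃ y ∈ N, ‖x - y‖ ≤ 1 / 2 := by
  classical
  set p : ℕ → Prop := fun k => ∃ s : Finset E, ((∀ c ∈ s, ‖c‖ ≤ 2) ∧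
    (∀ c ∈ s, ∀ d ∈ s, c ≠ d → 1 ≤ ‖c - d‖)) ∧ s.card = k with hp
  have h0 : p 0 := ⟨∅, by simp, rfl⟩
  obtain ⟨s, ⟨hs1, hs2⟩, hs3⟩ := Nat.findGreatest_spec (P := p)
    (Nat.zero_le (5 ^ Module.finrank ℝ E)) h0
  have hcard := Besicovitch.card_le_of_separated s hs1 hs2
  have hcover : ∀ x : E, ‖x‖ ≤ 2 → ∃ y ∈ s, ‖x - y‖ ≤ 1 := by
    intro x hx
    by_contra! hcon
    have hxs : x ∉ s := fun h => by
      have := hcon x h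
      simp at this
      linarith
    have h1 : (∀ c ∈ insert x s, ‖c‖ ≤ 2) := by
      intro c hc
      rcases Finset.mem_insert.1 hc with rfl | hc
      · exact hx
      · exact hs1 c hc
    have h2 : ∀ c ∈ insert x s, ∀ d ∈ insert x s, c ≠ d → 1 ≤ ‖c - d‖ := by
      intro c hc d hd hcd
      rcases Finset.mem_insert.1 hc with hc | hc <;> rcases Finset.mem_insert.1 hd with hd | hd
      · exact absurd (hc.trans hd.symm) hcd
      · rw [hc]; exact (hcon d hd).le
      · rw [hd, norm_sub_rev]; exact (hcon c hc).le
      · exact hs2 c hc d hd hcd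
    -- The enlarged set is again within the search bound of `Nat.findGreatest`, so it contradicts
    -- maximality.
    have h3 := Besicovitch.card_le_of_separated _ h1 h2
    have h4 : (insert x s).card = s.card + 1 := Finset.card_insert_of_notMem hxs
    rw [h4, hs3] at h3
    exact Nat.findGreatest_is_greatest (Nat.lt_succ_self _) h3
      ⟨insert x s, ⟨h1, h2⟩, by rw [h4, hs3]⟩
  refine ⟨s.image (fun y => (1 / 2 : ℝ) • y), Finset.card_image_le.trans hcard, ?_, ?_⟩
  · intro x hx
    obtain ⟨y, hy, rfl⟩ := Finset.mem_image.1 hx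
    have := hs1 y hy
    rw [norm_smul]
    norm_num
    linarith
  · intro x hx
    obtain ⟨y, hy, hxy⟩ := hcover ((2 : ℝ) • x) (by rw [norm_smul]; norm_num; linarith)
    refine ⟨_, Finset.mem_image_of_mem _ hy, ?_⟩
    have : x - (1 / 2 : ℝ) • y = (1 / 2 : ℝ) • ((2 : ℝ) • x - y) := by
      rw [smul_sub, smul_smul]; norm_num
    rw [this, norm_smul]
    norm_num
    linarith

/-- Approximating the vector on either side within 1/2 loses a factor 2 each time. Upper bounds on
real parts suffice because u ranges near the direction of T v. -/
lemma opNorm_le_of_net {E : Type} [NormedAddCommGroup E] [InnerProductSpace ℂ E]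
    (T : E →L[ℂ] E) {N : Finset E} (hN : ∀ x : E, ‖x‖ ≤ 1 → ∃ y ∈ N, ‖x - y‖ ≤ 1 / 2)
    {t : ℝ} (ht : 0 ≤ t) (h : ∀ u ∈ N, ∀ v ∈ N, (inner ℂ u (T v)).re ≤ t) : ‖T‖ ≤ 4 * t := by
  have h1 : ∀ v ∈ N, ‖T v‖ ≤ 2 * t := by
    intro v hv
    by_cases hx : T v = 0
    · rw [hx, norm_zero]; linarith
    have hx' : 0 < ‖T v‖ := norm_pos_iff.2 hx
    set u₀ : E := ((‖T v‖ : ℂ)⁻¹) • T v with hu₀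
    have hu₀n : ‖u₀‖ = 1 := by
      rw [hu₀, norm_smul, norm_inv, Complex.norm_real, norm_norm, inv_mul_cancel₀ hx'.ne']
    obtain ⟨u, hu, huu⟩ := hN u₀ hu₀n.le
    have h2 : (inner ℂ u₀ (T v)).re = ‖T v‖ := by
      rw [hu₀, inner_smul_left, inner_self_eq_norm_sq_to_K]
      have : (starRingEnd ℂ) ((‖T v‖ : ℂ)⁻¹) * (‖T v‖ : ℂ) ^ 2 = (‖T v‖ : ℂ) := by
        rw [map_inv₀, Complex.conj_ofReal]
        have : (‖T v‖ : ℂ) ≠ 0 := by exact_mod_cast hx'.ne'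
        field_simp
      have h3 := congrArg Complex.re this
      rwa [Complex.ofReal_re] at h3
    have h3 : (inner ℂ (u₀ - u) (T v)).re ≤ 1 / 2 * ‖T v‖ := by
      refine (Complex.re_le_norm _).trans ((norm_inner_le_norm _ _).trans ?_)
      gcongr
    rw [inner_sub_left, Complex.sub_re, h2] at h3
    have := h u hu v hv
    linarith
  have h2 : ‖T‖ ≤ 2 * t + ‖T‖ / 2 := by
    refine T.opNorm_le_of_unit_norm (by positivity) fun x hx => ?_
    obtain ⟨v, hv, hxv⟩ := hN x hx.le
    have h3 : T x = T v + T (x - v) := by rw [map_sub]; abel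
    rw [h3]
    refine (norm_add_le _ _).trans (add_le_add (h1 v hv) ?_)
    refine (T.le_opNorm _).trans ?_
    have := norm_nonneg T
    nlinarith
  linarith

lemma matrix_norm_le_of_net {M : ℕ} (X : Matrix (Fin M) (Fin M) ℂ)
    {N : Finset (EuclideanSpace ℂ (Fin M))}
    (hN : ∀ x : EuclideanSpace ℂ (Fin M), ‖x‖ ≤ 1 → ∃ y ∈ N, ‖x - y‖ ≤ 1 / 2) {t : ℝ}
    (ht : 0 ≤ t) (h : ∀ u ∈ N, ∀ v ∈ N, (∑ j, ∑ k, star (u j) * X j k * v k).re ≤ t) :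
    ‖X‖ ≤ 4 * t := by
  rw [Matrix.l2_opNorm_def]
  apply opNorm_le_of_net _ hN ht
  intro u hu v hv
  refine le_of_eq_of_le ?_ (h u hu v hv)
  congr 1
  simp only [LinearEquiv.trans_apply, LinearMap.coe_toContinuousLinearMap',
    Matrix.toLpLin_apply, PiLp.inner_apply, RCLike.inner_apply, mulVec, dotProduct]
  refine Finset.sum_congr rfl fun j _ => ?_
  rw [Finset.sum_mul]
  refine Finset.sum_congr rfl fun k _ => ?_
  rw [RCLike.star_def]
  ring

end Nets

/-! ### Concentration -/

section Concentration

open MeasureTheory ProbabilityTheory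

/-- Hoeffding's inequality for weighted sums of independent signs. -/
lemma hoeffding_signs {ι : Type} [Fintype ι] (ν : ι → Measure Bool)
    [∀ i, IsProbabilityMeasure (ν i)] (w : ι → ℝ) {σ t : ℝ}
    (hw : ∑ i, w i ^ 2 ≤ σ) (ht : 0 < t) :
    (Measure.pi ν).real {ω | t ≤ ∑ i, w i * (sgn (ω i) - ∫ b, sgn b ∂(ν i))}
      ≤ Real.exp (-t ^ 2 / (2 * σ)) := by
  set m : ι → ℝ := fun i => ∫ b, sgn b ∂(ν i) with hm
  -- Without any weight the event is empty. This case is separated because the final comparison of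
  -- exponents divides by the sum of squares.
  by_cases h0 : ∑ i, w i ^ 2 = 0
  · have hw0 : ∀ i, w i = 0 := by
      intro i
      have := (Finset.sum_eq_zero_iff_of_nonneg (fun i _ => sq_nonneg (w i))).1 h0 i
        (Finset.mem_univ i)
      exact pow_eq_zero_iff two_ne_zero |>.1 this
    have : {ω : ι → Bool | t ≤ ∑ i, w i * (sgn (ω i) - m i)} = ∅ := by
      ext ω
      simp [hw0, ht]
    rw [this, measureReal_empty]
    positivity
  have hpos : 0 < ∑ i, w i ^ 2 := lt_of_le_of_ne (Finset.sum_nonneg fun i _ => sq_nonneg _)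
    (Ne.symm h0)
  have hsub : ∀ i, HasSubgaussianMGF (fun b => w i * (sgn b - m i))
      (⟨w i ^ 2, sq_nonneg _⟩ * ((‖(1 : ℝ) - (-1)‖₊ / 2) ^ 2)) (ν i) := by
    intro i
    refine (hasSubgaussianMGF_of_mem_Icc (measurable_of_finite _).aemeasurable
      (Filter.Eventually.of_forall fun b => ?_)).const_mul (w i)
    cases b <;> simp [sgn]
  have hind : iIndepFun (fun i (ω : ι → Bool) => w i * (sgn (ω i) - m i)) (Measure.pi ν) :=
    iIndepFun_pi (X := fun i b => w i * (sgn b - m i))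
      fun i => (measurable_of_finite _).aemeasurable
  have hsub' : ∀ i ∈ Finset.univ, HasSubgaussianMGF
      (fun ω : ι → Bool => w i * (sgn (ω i) - m i))
      (⟨w i ^ 2, sq_nonneg _⟩ * ((‖(1 : ℝ) - (-1)‖₊ / 2) ^ 2)) (Measure.pi ν) := by
    intro i _
    have h1 := (measurePreserving_eval ν i)
    have h2 := hsub i
    rw [← h1.map_eq] at h2
    exact HasSubgaussianMGF.of_map (X := fun b => w i * (sgn b - m i)) h1.measurable.aemeasurable h2
  have h := HasSubgaussianMGF.measure_sum_ge_le_of_iIndepFun hind hsub' ht.le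
  refine h.trans (Real.exp_le_exp.2 ?_)
  have hc : ((∑ i, (⟨w i ^ 2, sq_nonneg _⟩ * ((‖(1 : ℝ) - (-1)‖₊ / 2) ^ 2) : NNReal) : NNReal) : ℝ)
      = ∑ i, w i ^ 2 := by
    push_cast
    refine Finset.sum_congr rfl fun i _ => ?_
    norm_num
    exact mul_one (w i ^ 2)
  rw [hc, neg_div, neg_div, neg_le_neg_iff]
  gcongr

variable {n M : ℕ}

lemma sysMatrix_gram (U : Fin M → Circuit (Fin n)) (a : Fin M → ℝ) (j k : Fin M) :
    ((sysMatrix U a)ᴴ * sysMatrix U a) j k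
      = a j * a k * ((U j).toMatrixᴴ * (U k).toMatrix) (zeroState _) (zeroState _) := by
  rw [Matrix.mul_apply, Matrix.mul_apply, Finset.mul_sum]
  refine Finset.sum_congr rfl fun x _ => ?_
  simp only [conjTranspose_apply, sysMatrix, Circuit.state, star_mul', RCLike.star_def,
    Complex.conj_ofReal]
  ring

lemma sum_sgn_record {S : ℕ} (ω : Record M S) (j k : Fin M) (im : Bool) :
    ∑ r, sgn (ω (j, k, im, r)) = 2 * (zeroCount ω j k im : ℝ) - S := by
  have h : ∀ r, sgn (ω (j, k, im, r)) = 2 * (if ω (j, k, im, r) = false then 1 else 0) - 1 := by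
    intro r
    unfold sgn
    split_ifs <;> norm_num
  simp_rw [h, Finset.sum_sub_distrib, ← Finset.mul_sum, zeroCount]
  simp

/-- The coefficient of `⟨aⱼ|aₖ⟩` in the sesquilinear form of `A† A` at `u, v`. -/
def formCoeff (a : Fin M → ℝ) (u v : Fin M → ℂ) (j k : Fin M) : ℂ :=
  star (u j) * (a j * a k) * v k

/-- The weight of a run in the sesquilinear form of the estimation error. -/
def weight (a : Fin M → ℝ) (S : ℕ) (u v : Fin M → ℂ) (i : Fin M × Fin M × Bool × Fin S) : ℝ :=
  (S : ℝ)⁻¹ * part i.2.2.1 (star (formCoeff a u v i.1 i.2.1))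

/-- From Re(q(x + iy)) = Re q · x − Im q · y, the real and imaginary tests carry the weights Re q̄
and Im q̄. Hence the error of the form is linear in the independent centred signs. -/
lemma form_error_eq {S : ℕ} (hS : 0 < S) (a : Fin M → ℝ) (U : Fin M → Circuit (Fin n))
    (ω : Record M S) (u v : Fin M → ℂ) :
    (∑ j, ∑ k, star (u j) * (VHat a S (zeroCount ω) - (sysMatrix U a)ᴴ * sysMatrix U a) j k
      * v k).re
      = ∑ i : Fin M × Fin M × Bool × Fin S, weight a S u v i * (sgn (ω i) - part i.2.2.1
          (((U i.1).toMatrixᴴ * (U i.2.1).toMatrix) (zeroState _) (zeroState _))) := by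
  have hS' : (S : ℝ) ≠ 0 := by exact_mod_cast hS.ne'
  simp only [Fintype.sum_prod_type, Complex.re_sum]
  refine Finset.sum_congr rfl fun j _ => Finset.sum_congr rfl fun k _ => ?_
  set g := ((U j).toMatrixᴴ * (U k).toMatrix) (zeroState _) (zeroState _) with hg
  rw [Matrix.sub_apply, sysMatrix_gram, ← hg, VHat]
  have h1 : ∀ im : Bool, ∑ r : Fin S, weight a S u v (j, k, im, r)
      * (sgn (ω (j, k, im, r)) - part im g)
      = part im (star (formCoeff a u v j k))
        * (2 * (zeroCount ω j k im : ℝ) / S - 1 - part im g) := by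
    intro im
    simp only [weight]
    rw [← Finset.mul_sum, Finset.sum_sub_distrib, sum_sgn_record]
    simp only [Finset.sum_const, Finset.card_univ, Fintype.card_fin, nsmul_eq_mul]
    field_simp
  simp only [h1, Fintype.sum_bool]
  have h2 : star (u j) * (a j * a k * vHat S (zeroCount ω) j k - a j * a k * g) * v k
      = formCoeff a u v j k * (((2 * (zeroCount ω j k false : ℝ) / S - 1 : ℝ) : ℂ)
        + ((2 * (zeroCount ω j k true : ℝ) / S - 1 : ℝ) : ℂ) * Complex.I - g) := by
    unfold formCoeff vHat
    push_cast
    ring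
  rw [h2]
  simp [part]
  ring

lemma sq_le_gammaTwo (a : Fin M → ℝ) (j : Fin M) : a j ^ 2 ≤ gammaTwo a :=
  le_ciSup (f := fun j => a j ^ 2) (Set.finite_range _).bddAbove j

/-- Summing over the runs leaves |q|²/S for each pair, and |q|² ≤ Γ₂²|u_j|²|v_k|² sums to at most
Γ₂² in the unit ball. The dimension does not enter, which an entrywise estimate of V̂ would not
achieve. -/
lemma sum_weight_sq_le {S : ℕ} (hS : 0 < S) (a : Fin M → ℝ) (u v : EuclideanSpace ℂ (Fin M))
    (hu : ‖u‖ ≤ 1) (hv : ‖v‖ ≤ 1) :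
    ∑ i, weight a S u v i ^ 2 ≤ gammaTwo a ^ 2 / S := by
  have hS' : (S : ℝ) ≠ 0 := by exact_mod_cast hS.ne'
  have h1 : ∀ q : ℂ, part true (star q) ^ 2 + part false (star q) ^ 2 = ‖q‖ ^ 2 := by
    intro q
    rw [Complex.sq_norm, Complex.normSq_apply]
    simp [part]
    ring
  simp only [Fintype.sum_prod_type, weight, mul_pow, Finset.sum_const, Finset.card_univ,
    Fintype.card_fin, nsmul_eq_mul, Fintype.sum_bool]
  have h2 : ∀ j k, (S : ℝ) * ((S : ℝ)⁻¹ ^ 2 * part true (star (formCoeff a u v j k)) ^ 2)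
      + (S : ℝ) * ((S : ℝ)⁻¹ ^ 2 * part false (star (formCoeff a u v j k)) ^ 2)
      = ‖formCoeff a u v j k‖ ^ 2 / S := by
    intro j k
    rw [← h1]
    field_simp
  simp only [h2, ← Finset.sum_div]
  refine div_le_div_of_nonneg_right ?_ (by positivity)
  have h3 : ∀ j k, ‖formCoeff a u v j k‖ ^ 2 ≤ gammaTwo a ^ 2 * (‖u j‖ ^ 2 * ‖v k‖ ^ 2) := by
    intro j k
    have e : ‖formCoeff a u v j k‖ ^ 2 = (a j ^ 2 * a k ^ 2) * (‖u j‖ ^ 2 * ‖v k‖ ^ 2) := by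
      simp only [formCoeff, norm_mul, norm_star, Complex.norm_real, Real.norm_eq_abs, mul_pow,
        sq_abs]
      ring
    rw [e, pow_two (gammaTwo a)]
    have hj := sq_le_gammaTwo a j
    have hk := sq_le_gammaTwo a k
    have := (sq_nonneg (a j)).trans hj
    gcongr
  calc ∑ j, ∑ k, ‖formCoeff a u v j k‖ ^ 2
      ≤ ∑ j, ∑ k, gammaTwo a ^ 2 * (‖u j‖ ^ 2 * ‖v k‖ ^ 2) :=
        Finset.sum_le_sum fun j _ => Finset.sum_le_sum fun k _ => h3 j k
    _ = gammaTwo a ^ 2 * (‖u‖ ^ 2 * ‖v‖ ^ 2) := by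
        rw [EuclideanSpace.norm_sq_eq, EuclideanSpace.norm_sq_eq, Finset.sum_mul_sum,
          Finset.mul_sum]
        simp only [Finset.mul_sum]
    _ ≤ gammaTwo a ^ 2 * (1 * 1) := by
        gcongr
        · exact pow_le_one₀ (norm_nonneg _) hu
        · exact pow_le_one₀ (norm_nonneg _) hv
    _ = _ := by ring

/-- Concentration of the estimate of `A† A` in spectral norm. -/
lemma estimate_concentration {S : ℕ} (hS : 0 < S) (a : Fin M → ℝ)
    (U : Fin M → Circuit (Fin n)) (test : Fin M → Fin M → Bool → Circuit (Option (Fin n)))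
    (htest : ∀ j k im, IsHadamardTest (test j k im) im ((U j).toMatrixᴴ * (U k).toMatrix))
    {t : ℝ} (ht : 0 < t) :
    1 - 625 ^ M * Real.exp (-t ^ 2 / (2 * (gammaTwo a ^ 2 / S))) ≤
      (recordLaw test S).real {ω | ‖VHat a S (zeroCount ω)
        - (sysMatrix U a)ᴴ * sysMatrix U a‖ ≤ 4 * t} := by
  have hu : ∀ j k, (U j).toMatrixᴴ * (U k).toMatrix ∈ unitaryGroup (Fin n → Bool) ℂ :=
    fun j k => mul_mem (Unitary.star_mem (U j).toMatrix_mem) (U k).toMatrix_mem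
  have : ∀ i : Fin M × Fin M × Bool × Fin S,
      IsProbabilityMeasure ((test i.1 i.2.1 i.2.2.1).outcomeLaw none) :=
    fun i => isProbabilityMeasure_outcomeLaw (hu _ _) (htest _ _ _)
  have : IsProbabilityMeasure (recordLaw test S) := by
    unfold recordLaw; infer_instance
  obtain ⟨N, hNcard, hN1, hNnet⟩ := exists_net (EuclideanSpace ℂ (Fin M))
  have hfin : Module.finrank ℝ (EuclideanSpace ℂ (Fin M)) = 2 * M := by
    rw [finrank_real_of_complex, finrank_euclideanSpace, Fintype.card_fin]
  rw [hfin] at hNcard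
  set bad : EuclideanSpace ℂ (Fin M) × EuclideanSpace ℂ (Fin M) → Set (Record M S) := fun p =>
    {ω | t ≤ ∑ i, weight a S p.1 p.2 i * (sgn (ω i) -
      ∫ b, sgn b ∂((test i.1 i.2.1 i.2.2.1).outcomeLaw none))} with hbad
  have hbadle : ∀ p ∈ N ×ˢ N, (recordLaw test S).real (bad p)
      ≤ Real.exp (-t ^ 2 / (2 * (gammaTwo a ^ 2 / S))) := by
    intro p hp
    obtain ⟨h1, h2⟩ := Finset.mem_product.1 hp
    exact hoeffding_signs _ _ (sum_weight_sq_le hS a p.1 p.2 (hN1 _ h1) (hN1 _ h2)) ht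
  set bads : Set (Record M S) := ⋃ p ∈ N ×ˢ N, bad p with hbads
  have hunion : (recordLaw test S).real bads
      ≤ 625 ^ M * Real.exp (-t ^ 2 / (2 * (gammaTwo a ^ 2 / S))) := by
    refine (measureReal_biUnion_finset_le _ _).trans ?_
    refine (Finset.sum_le_card_nsmul _ _ _ hbadle).trans ?_
    rw [nsmul_eq_mul, Finset.card_product]
    gcongr
    have h1 : N.card * N.card ≤ 5 ^ (2 * M) * 5 ^ (2 * M) := Nat.mul_le_mul hNcard hNcard
    -- The real dimension is 2M and pairs of net points are counted, whence 5^(4M) = 625^M.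
    have h2 : 5 ^ (2 * M) * 5 ^ (2 * M) = 625 ^ M := by
      rw [← pow_add, show 2 * M + 2 * M = 4 * M by ring, pow_mul]
      norm_num
    exact_mod_cast h1.trans h2.le
  have hcompl : (recordLaw test S).real badsᶜ = 1 - (recordLaw test S).real bads :=
    probReal_compl_eq_one_sub (Set.toFinite _).measurableSet
  have hsub : badsᶜ ⊆ {ω | ‖VHat a S (zeroCount ω)
      - (sysMatrix U a)ᴴ * sysMatrix U a‖ ≤ 4 * t} := by
    intro ω hω
    apply matrix_norm_le_of_net _ hNnet ht.le
    intro u hu' v hv'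
    rw [form_error_eq hS]
    have h1 : ω ∉ bad (u, v) := fun h => hω (Set.mem_biUnion (Finset.mk_mem_product hu' hv') h)
    simp only [hbad, Set.mem_ofPred_eq, not_le] at h1
    refine le_trans (le_of_eq (Finset.sum_congr rfl fun i _ => ?_)) h1.le
    rw [integral_sgn_outcomeLaw (hu _ _) (htest _ _ _)]
  have := measureReal_mono (μ := recordLaw test S) hsub
  linarith

end Concentration

/-! ### Straight-line computations -/

section StraightLine

variable {I : Type}

/-- After `code` has run, some input register or written register holds the value of `f`. -/
def Computes (code : List (Instr (I ⊕ ℕ))) (f : (I → ℂ) → ℂ) : Prop :=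
  ∃ r : I ⊕ ℕ, (∀ w, r = Sum.inr w → w < code.length) ∧
    ∀ x, code.foldl Instr.exec (Sum.elim x fun _ => 0) r = f x

/-- The functions in `S` can be computed simultaneously in `k` steps. -/
def Reach (k : ℕ) (S : Set ((I → ℂ) → ℂ)) : Prop :=
  ∃ code : List (Instr (I ⊕ ℕ)), code.length ≤ k ∧ ∀ f ∈ S, Computes code f

/-- Whenever the functions in `S` are available, `m` further steps make those in `T` available. -/
def Derives (S T : Set ((I → ℂ) → ℂ)) (m : ℕ) : Prop :=
  ∀ k R, S ⊆ R → Reach k R → Reach (k + m) (R ∪ T)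

variable {S S' T T' R : Set ((I → ℂ) → ℂ)} {f g : (I → ℂ) → ℂ} {k m m' : ℕ}

lemma reach_inputs : Reach 0 (Set.range fun (i : I) (x : I → ℂ) => x i) := by
  refine ⟨[], le_rfl, ?_⟩
  rintro _ ⟨i, rfl⟩
  exact ⟨Sum.inl i, by simp, fun x => rfl⟩

lemma Reach.mono (h : Reach k S) (hS : S' ⊆ S) : Reach k S' := by
  obtain ⟨code, h1, h2⟩ := h
  exact ⟨code, h1, fun f hf => h2 f (hS hf)⟩

lemma Reach.mono_right (h : Reach k S) (hk : k ≤ m) : Reach m S := by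
  obtain ⟨code, h1, h2⟩ := h
  exact ⟨code, h1.trans hk, h2⟩

lemma Reach.derive (h : Reach k R) (hd : Derives R T m) : Reach (k + m) (R ∪ T) :=
  hd k R subset_rfl h

lemma Derives.mono (h : Derives S T m) (hS : S ⊆ S') (hT : T' ⊆ T) (hm : m ≤ m') :
    Derives S' T' m' := fun k R hR hk =>
  ((h k R (hS.trans hR) hk).mono (Set.union_subset_union_right _ hT)).mono_right (by omega)

/-- Since `Derives` quantifies over every larger set of available functions, derivations compose
like sequents and earlier results are never lost. -/
lemma Derives.trans (h : Derives S T m) (h' : Derives (S ∪ T) T' m') :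
    Derives S (T ∪ T') (m + m') := fun k R hR hk => by
  have := h' _ _ (Set.union_subset_union_left _ hR) (h k R hR hk)
  rwa [Set.union_assoc, add_assoc] at this

lemma Derives.union (h : Derives S T m) (h' : Derives S T' m') :
    Derives S (T ∪ T') (m + m') :=
  h.trans (h'.mono Set.subset_union_left subset_rfl le_rfl)

lemma Derives.of_mem (h : f ∈ S) : Derives S {f} 0 := fun _ _ hR hk =>
  hk.mono (Set.union_subset subset_rfl (Set.singleton_subset_iff.2 (hR h)))

lemma Derives.empty : Derives S ∅ 0 := fun k R _ hk => by simpa using hk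

lemma Derives.biUnion {ι : Type} (s : Finset ι) {T : ι → Set ((I → ℂ) → ℂ)}
    (h : ∀ i ∈ s, Derives S (T i) m) : Derives S (⋃ i ∈ s, T i) (s.card * m) := by
  classical
  induction s using Finset.induction_on with
  | empty => simpa using Derives.empty
  | insert i s hi ih =>
    have h1 := (h i (by simp)).union (ih fun j hj => h j (by simp [hj]))
    rw [Finset.card_insert_of_notMem hi, Finset.set_biUnion_insert]
    exact h1.mono subset_rfl subset_rfl (by ring_nf; rfl)

lemma Derives.iUnion {ι : Type} [Fintype ι] {T : ι → Set ((I → ℂ) → ℂ)}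
    (h : ∀ i, Derives S (T i) m) : Derives S (⋃ i, T i) (Fintype.card ι * m) := by
  have := Derives.biUnion Finset.univ (fun i _ => h i)
  simpa using this

/-- The new instruction writes to the register numbered by the current code length. By the bound in
`Computes`, no value in use is stored there. -/
lemma derives_of_instr (hI : ∀ code : List (Instr (I ⊕ ℕ)), (∀ f ∈ S, Computes code f) →
    ∃ ins : Instr (I ⊕ ℕ), ∀ x,
      (∀ r, r ≠ Sum.inr code.length →
        Instr.exec (code.foldl Instr.exec (Sum.elim x fun _ => 0)) ins r
          = code.foldl Instr.exec (Sum.elim x fun _ => 0) r) ∧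
      Instr.exec (code.foldl Instr.exec (Sum.elim x fun _ => 0)) ins (Sum.inr code.length)
        = g x) : Derives S {g} 1 := by
  rintro k R hR ⟨code, hlen, hcode⟩
  obtain ⟨ins, hins⟩ := hI code fun f hf => hcode f (hR hf)
  refine ⟨code ++ [ins], by simpa using hlen, ?_⟩
  rintro f (hf | rfl)
  · obtain ⟨r, hr, hrv⟩ := hcode f hf
    refine ⟨r, fun w hw => by have := hr w hw; simp; omega, fun x => ?_⟩
    rw [List.foldl_append, List.foldl_cons, List.foldl_nil, (hins x).1, hrv]
    intro h
    exact absurd (hr _ h) (lt_irrefl _)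
  · refine ⟨Sum.inr code.length, fun w hw => ?_, fun x => ?_⟩
    · cases hw
      simp
    · rw [List.foldl_append, List.foldl_cons, List.foldl_nil, (hins x).2]

open Classical in
lemma update_facts {R : Type} (mem : R → ℂ) (d : R) (v : ℂ) :
    (∀ r, r ≠ d → Function.update mem d v r = mem r) ∧ Function.update mem d v d = v :=
  ⟨fun _ hr => Function.update_of_ne hr _ _, Function.update_self _ _ _⟩

lemma derives_one : Derives S {fun _ => 1} 1 :=
  derives_of_instr fun code _ => ⟨.one (Sum.inr code.length), fun _ => update_facts _ _ _⟩

lemma derives_I : Derives S {fun _ => Complex.I} 1 :=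
  derives_of_instr fun code _ => ⟨.imag (Sum.inr code.length), fun _ => update_facts _ _ _⟩

lemma Derives.star (h : Derives S {f} m) : Derives S {fun x => star (f x)} (m + 1) := by
  refine (h.trans (derives_of_instr fun code hc => ?_)).mono subset_rfl
    (Set.subset_union_right) le_rfl
  obtain ⟨r, -, hr⟩ := hc f (by simp)
  exact ⟨.conj (Sum.inr code.length) r, fun x =>
    ⟨(update_facts _ _ _).1, by rw [← hr x]; exact (update_facts _ _ _).2⟩⟩

lemma Derives.binary (mk : (I ⊕ ℕ) → (I ⊕ ℕ) → (I ⊕ ℕ) → Instr (I ⊕ ℕ)) (op : ℂ → ℂ → ℂ)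
    (hmk : ∀ mem d x y, (∀ r, r ≠ d → Instr.exec mem (mk d x y) r = mem r) ∧
      Instr.exec mem (mk d x y) d = op (mem x) (mem y))
    (h : Derives S {f} m) (h' : Derives S {g} m') :
    Derives S {fun x => op (f x) (g x)} (m + m' + 1) := by
  refine ((h.union h').trans (derives_of_instr fun code hc => ?_)).mono subset_rfl
    (Set.subset_union_right) le_rfl
  obtain ⟨r, -, hr⟩ := hc f (by simp)
  obtain ⟨r', -, hr'⟩ := hc g (by simp)
  refine ⟨mk (Sum.inr code.length) r r', fun x => ⟨(hmk _ _ _ _).1, ?_⟩⟩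
  rw [(hmk _ _ _ _).2, hr, hr']

lemma Derives.add (h : Derives S {f} m) (h' : Derives S {g} m') :
    Derives S {fun x => f x + g x} (m + m' + 1) :=
  Derives.binary .add (· + ·) (fun _ _ _ _ => update_facts _ _ _) h h'

lemma Derives.sub (h : Derives S {f} m) (h' : Derives S {g} m') :
    Derives S {fun x => f x - g x} (m + m' + 1) :=
  Derives.binary .sub (· - ·) (fun _ _ _ _ => update_facts _ _ _) h h'

lemma Derives.mul (h : Derives S {f} m) (h' : Derives S {g} m') :
    Derives S {fun x => f x * g x} (m + m' + 1) :=
  Derives.binary .mul (· * ·) (fun _ _ _ _ => update_facts _ _ _) h h'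

lemma Derives.div (h : Derives S {f} m) (h' : Derives S {g} m') :
    Derives S {fun x => f x / g x} (m + m' + 1) :=
  Derives.binary .div (· / ·) (fun _ _ _ _ => update_facts _ _ _) h h'

lemma Derives.of_eq (h : Derives S {f} m) (hfg : ∀ x, f x = g x) (hm : m ≤ m') :
    Derives S {g} m' := by
  obtain rfl : f = g := funext hfg
  exact h.mono subset_rfl subset_rfl hm

/-- Unwritten registers hold 0, but `Computes` admits only inputs and written ones, so zero is
computed as 1 − 1. -/
lemma derives_zero : Derives S {fun _ => 0} 3 :=
  (derives_one.sub derives_one).of_eq (fun _ => sub_self 1) le_rfl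

lemma Derives.sum {ι : Type} (s : Finset ι) {F : ι → (I → ℂ) → ℂ}
    (h : ∀ i ∈ s, Derives S {F i} m) :
    Derives S {fun x => ∑ i ∈ s, F i x} (s.card * (m + 1) + 3) := by
  classical
  induction s using Finset.induction_on with
  | empty => simpa using derives_zero
  | insert i s hi ih =>
    have h1 := (h i (by simp)).add (ih fun j hj => h j (by simp [hj]))
    rw [Finset.card_insert_of_notMem hi]
    exact h1.of_eq (fun x => by rw [Finset.sum_insert hi]) (by ring_nf; rfl)

lemma Reach.exists_program {O : Type} {F : O → (I → ℂ) → ℂ} (h : Reach k S)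
    (hF : ∀ o, F o ∈ S) :
    ∃ P : Program I O, P.steps ≤ k ∧ ∀ x o, P.eval x o = F o x := by
  obtain ⟨code, hlen, hcode⟩ := h
  choose r _ hr using fun o => hcode (F o) (hF o)
  exact ⟨⟨ℕ, code, r⟩, hlen, fun x o => hr o x⟩

end StraightLine

/-! ### Solving a linear system by orthogonalization of its rows -/

section Solver

variable {M : ℕ}

/-- The conjugate of a row. -/
def rowVec (Q : Matrix (Fin M) (Fin M) ℂ) (i : Fin M) : EuclideanSpace ℂ (Fin M) :=
  WithLp.toLp 2 fun j => star (Q i j)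

/-- The orthogonalized rows. -/
def orthoRow (Q : Matrix (Fin M) (Fin M) ℂ) (i : Fin M) : EuclideanSpace ℂ (Fin M) :=
  InnerProductSpace.gramSchmidt ℂ (rowVec Q) i

/-- The squared norm of an orthogonalized row. -/
def rowNormSq (Q : Matrix (Fin M) (Fin M) ℂ) (i : Fin M) : ℂ :=
  ∑ m, star (orthoRow Q i m) * orthoRow Q i m

/-- The coefficient of the projection of row `i` onto the orthogonalized row `l`. -/
def rowCoeff (Q : Matrix (Fin M) (Fin M) ℂ) (l i : Fin M) : ℂ :=
  (∑ m, star (orthoRow Q l m) * star (Q i m)) / rowNormSq Q l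

lemma inner_eq_sum (u v : EuclideanSpace ℂ (Fin M)) : inner ℂ u v = ∑ m, star (u m) * v m := by
  rw [PiLp.inner_apply]
  refine Finset.sum_congr rfl fun m _ => ?_
  rw [RCLike.inner_apply, RCLike.star_def, mul_comm]

lemma rowNormSq_eq_inner (Q : Matrix (Fin M) (Fin M) ℂ) (i : Fin M) :
    rowNormSq Q i = inner ℂ (orthoRow Q i) (orthoRow Q i) := by
  rw [inner_eq_sum]; rfl

lemma rowVec_eq (Q : Matrix (Fin M) (Fin M) ℂ) (i : Fin M) :
    rowVec Q i = orthoRow Q i + ∑ l ∈ Finset.Iio i, rowCoeff Q l i • orthoRow Q l := by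
  have h := InnerProductSpace.gramSchmidt_def'' ℂ (rowVec Q) i
  rw [h]
  congr 1
  refine Finset.sum_congr rfl fun l _ => ?_
  congr 1
  rw [rowCoeff, rowNormSq_eq_inner, inner_self_eq_norm_sq_to_K, inner_eq_sum]
  rfl

lemma orthoRow_apply (Q : Matrix (Fin M) (Fin M) ℂ) (i j : Fin M) :
    orthoRow Q i j = star (Q i j) - ∑ l ∈ Finset.Iio i, rowCoeff Q l i * orthoRow Q l j := by
  have h := congrArg (fun v : EuclideanSpace ℂ (Fin M) => v j) (rowVec_eq Q i)
  simp only [PiLp.add_apply, WithLp.ofLp_sum, Finset.sum_apply, PiLp.smul_apply, smul_eq_mul] at h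
  rw [eq_sub_iff_add_eq, ← h]
  rfl

lemma inner_rowVec (Q : Matrix (Fin M) (Fin M) ℂ) (i : Fin M) (v : EuclideanSpace ℂ (Fin M)) :
    inner ℂ (rowVec Q i) v = (Q *ᵥ v.ofLp) i := by
  rw [inner_eq_sum, mulVec, dotProduct]
  refine Finset.sum_congr rfl fun m _ => ?_
  rw [rowVec, star_star]

/-- This is what the solver rests on: adding a multiple of the orthogonalized row k leaves the
equations before k intact. -/
lemma inner_rowVec_orthoRow_of_lt (Q : Matrix (Fin M) (Fin M) ℂ) {i k : Fin M} (h : i < k) :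
    inner ℂ (rowVec Q i) (orthoRow Q k) = 0 := by
  rw [inner_eq_zero_symm]
  exact InnerProductSpace.gramSchmidt_inv_triangular ℂ (rowVec Q) h

lemma inner_rowVec_orthoRow_self (Q : Matrix (Fin M) (Fin M) ℂ) (i : Fin M) :
    inner ℂ (rowVec Q i) (orthoRow Q i) = rowNormSq Q i := by
  rw [rowVec_eq, inner_add_left, sum_inner, rowNormSq_eq_inner]
  rw [Finset.sum_eq_zero, add_zero]
  intro l hl
  rw [inner_smul_left]
  have : inner ℂ (orthoRow Q l) (orthoRow Q i) = 0 :=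
    InnerProductSpace.gramSchmidt_orthogonal ℂ (rowVec Q) (Finset.mem_Iio.1 hl).ne
  rw [this, mul_zero]

lemma linearIndependent_rowVec {Q : Matrix (Fin M) (Fin M) ℂ} (hQ : IsUnit Q.det) :
    LinearIndependent ℂ (rowVec Q) := by
  have h1 : IsUnit (Qᴴᵀ) := by
    rw [isUnit_iff_isUnit_det, det_transpose, det_conjTranspose]
    exact hQ.star
  have h2 := linearIndependent_rows_iff_isUnit.2 h1
  exact h2.map' (WithLp.linearEquiv 2 ℂ (Fin M → ℂ)).symm.toLinearMap (LinearEquiv.ker _)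

/-- A straight-line program cannot branch to choose pivots. Unnormalized Gram–Schmidt divides only
by these squared norms, which are nonzero for every invertible matrix. -/
lemma rowNormSq_ne_zero {Q : Matrix (Fin M) (Fin M) ℂ} (hQ : IsUnit Q.det) (i : Fin M) :
    rowNormSq Q i ≠ 0 := by
  rw [rowNormSq_eq_inner, inner_self_ne_zero]
  exact InnerProductSpace.gramSchmidt_ne_zero i (linearIndependent_rowVec hQ)

/-- The coefficient of the orthogonalized row `k` in the correction that makes the approximate
solution `v` satisfy equation `k`. -/
def stepCoeff (Q : Matrix (Fin M) (Fin M) ℂ) (b v : Fin M → ℂ) (k : Fin M) : ℂ :=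
  (b k - ∑ j, Q k j * v j) / rowNormSq Q k

/-- The solution of the first `k` equations of the system `Q x = b`. -/
def partialSol (Q : Matrix (Fin M) (Fin M) ℂ) (b : Fin M → ℂ) : ℕ → Fin M → ℂ
  | 0 => 0
  | k + 1 => if h : k < M then
      partialSol Q b k + stepCoeff Q b (partialSol Q b k) ⟨k, h⟩ • (orthoRow Q ⟨k, h⟩).ofLp
    else partialSol Q b k

/-- Step k changes the left side of equation k by the coefficient times the squared norm of the
orthogonalized row, exactly the defect, and does not disturb the equations already satisfied. -/
lemma mulVec_partialSol {Q : Matrix (Fin M) (Fin M) ℂ} (hQ : IsUnit Q.det) (b : Fin M → ℂ)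
    (k : ℕ) (i : Fin M) (hi : (i : ℕ) < k) : (Q *ᵥ partialSol Q b k) i = b i := by
  induction k with
  | zero => omega
  | succ k ih =>
    rw [partialSol]
    split_ifs with h
    · rw [mulVec_add, mulVec_smul, Pi.add_apply, Pi.smul_apply,
        ← inner_rowVec Q i (orthoRow Q ⟨k, h⟩)]
      rcases Nat.lt_succ_iff_lt_or_eq.1 hi with h1 | h1
      · rw [inner_rowVec_orthoRow_of_lt Q (show i < ⟨k, h⟩ from h1), ih h1, smul_zero, add_zero]
      · have h2 : i = ⟨k, h⟩ := Fin.ext h1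
        rw [← h2, inner_rowVec_orthoRow_self, stepCoeff, smul_eq_mul,
          div_mul_cancel₀ _ (rowNormSq_ne_zero hQ i)]
        simp [mulVec, dotProduct]
    · exact ih (by have := i.2; omega)

lemma partialSol_eq {Q : Matrix (Fin M) (Fin M) ℂ} (hQ : IsUnit Q.det) (b : Fin M → ℂ) :
    partialSol Q b M = Q⁻¹ *ᵥ b := by
  symm
  apply inv_mulVec_eq hQ
  funext i
  exact mulVec_partialSol hQ b M i i.2

variable {I : Type} {k : ℕ} {R : Set ((I → ℂ) → ℂ)} {Q : (I → ℂ) → Matrix (Fin M) (Fin M) ℂ}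
  {b : (I → ℂ) → Fin M → ℂ}

lemma derives_rowNormSq {l : Fin M} (h : ∀ j, (fun x => orthoRow (Q x) l j) ∈ R) :
    Derives R {fun x => rowNormSq (Q x) l} (3 * M + 3) := by
  refine (Derives.sum Finset.univ fun m _ =>
    (Derives.of_mem (h m)).star.mul (Derives.of_mem (h m))).of_eq (fun x => rfl) ?_
  simp
  omega

lemma reach_orthoRow (hR : Reach k R) (hQ : ∀ i j, (fun x => Q x i j) ∈ R) (t : ℕ) (ht : t ≤ M) :
    Reach (k + t * (21 * M ^ 2))
      (R ∪ {f | ∃ l : Fin M, (l : ℕ) < t ∧ ∃ j, f = fun x => orthoRow (Q x) l j}) := by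
  induction t with
  | zero => simpa using hR
  | succ t ih =>
    have ht' : t < M := ht
    set i : Fin M := ⟨t, ht'⟩ with hi
    set R' := R ∪ {f | ∃ l : Fin M, (l : ℕ) < t ∧ ∃ j, f = fun x => orthoRow (Q x) l j} with hR'
    have hmem : ∀ l ∈ Finset.Iio i, ∀ j, (fun x => orthoRow (Q x) l j) ∈ R' := by
      intro l hl j
      exact Or.inr ⟨l, Fin.lt_def.1 (Finset.mem_Iio.1 hl), j, rfl⟩
    have hcard : (Finset.Iio i).card ≤ M := (Finset.card_le_univ _).trans (by simp)
    have h1 : Derives R' (⋃ l ∈ Finset.Iio i, {fun x => rowCoeff (Q x) l i})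
        ((Finset.Iio i).card * (7 * M + 7)) := by
      refine Derives.biUnion _ fun l hl => ?_
      have hnum : Derives R' {fun x => ∑ m, star (orthoRow (Q x) l m) * star (Q x i m)}
          (4 * M + 3) := by
        refine (Derives.sum Finset.univ fun m _ => (Derives.of_mem (hmem l hl m)).star.mul
          (Derives.of_mem (f := fun x => Q x i m) (Or.inl (hQ i m))).star).of_eq (fun x => rfl) ?_
        simp
        omega
      exact (hnum.div (derives_rowNormSq (hmem l hl))).of_eq (fun x => rfl) (by omega)
    have h2 : Derives (R' ∪ ⋃ l ∈ Finset.Iio i, {fun x => rowCoeff (Q x) l i})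
        (⋃ j : Fin M, {fun x => orthoRow (Q x) i j}) (Fintype.card (Fin M) * (2 * M + 5)) := by
      refine Derives.iUnion fun j => ?_
      have hq : (fun x => Q x i j) ∈ R' ∪ ⋃ l ∈ Finset.Iio i, {fun x => rowCoeff (Q x) l i} :=
        Or.inl (Or.inl (hQ i j))
      refine ((Derives.of_mem hq).star.sub (Derives.sum (Finset.Iio i)
        (F := fun l x => rowCoeff (Q x) l i * orthoRow (Q x) l j) fun l hl =>
          (Derives.of_mem (Or.inr ?_)).mul (Derives.of_mem (Or.inl (hmem l hl j))))).of_eq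
        (fun x => (orthoRow_apply (Q x) i j).symm) ?_
      · simp only [Set.mem_iUnion, Set.mem_singleton_iff]
        exact ⟨l, hl, rfl⟩
      · nlinarith
    refine (((ih ht'.le).derive h1).derive h2).mono ?_ |>.mono_right ?_
    · rintro f (hf | ⟨l, hl, j, rfl⟩)
      · exact Or.inl (Or.inl (Or.inl hf))
      · rcases Nat.lt_succ_iff_lt_or_eq.1 hl with h3 | h3
        · exact Or.inl (Or.inl (Or.inr ⟨l, h3, j, rfl⟩))
        · refine Or.inr ?_
          have : l = i := Fin.ext h3
          simp only [Set.mem_iUnion, Set.mem_singleton_iff]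
          exact ⟨j, by rw [this]⟩
    -- One row costs at most M(7M + 7) for its coefficients and M(2M + 5) for its entries, hence 9M²
    -- + 12M ≤ 21M².
    · rw [Fintype.card_fin]
      have h4 := Nat.mul_le_mul_right (7 * M + 7) hcard
      have h5 : M ≤ M ^ 2 := Nat.le_self_pow two_ne_zero M
      nlinarith

lemma reach_partialSol (hR : Reach k R) (hQ : ∀ i j, (fun x => Q x i j) ∈ R)
    (hb : ∀ i, (fun x => b x i) ∈ R) (ho : ∀ i j, (fun x => orthoRow (Q x) i j) ∈ R)
    (t : ℕ) (ht : t ≤ M) :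
    Reach (k + 3 + t * (7 * M + 8)) (R ∪ {f | ∃ j, f = fun x => partialSol (Q x) (b x) t j}) := by
  induction t with
  | zero =>
    refine ((hR.derive derives_zero).mono ?_).mono_right (by omega)
    rintro f (hf | ⟨j, rfl⟩)
    · exact Or.inl hf
    · exact Or.inr rfl
  | succ t ih =>
    have ht' : t < M := ht
    set i : Fin M := ⟨t, ht'⟩ with hi
    set R' := R ∪ {f | ∃ j, f = fun x => partialSol (Q x) (b x) t j} with hR'
    have hp : ∀ j, (fun x => partialSol (Q x) (b x) t j) ∈ R' := fun j => Or.inr ⟨j, rfl⟩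
    have h1 : Derives R' {fun x => stepCoeff (Q x) (b x) (partialSol (Q x) (b x) t) i}
        (5 * M + 8) := by
      have hs : Derives R' {fun x => ∑ j, Q x i j * partialSol (Q x) (b x) t j} (2 * M + 3) := by
        refine (Derives.sum Finset.univ fun j _ => (Derives.of_mem
          (f := fun x => Q x i j) (Or.inl (hQ i j))).mul (Derives.of_mem (hp j))).of_eq
            (fun x => rfl) ?_
        simp
        omega
      refine (((Derives.of_mem (f := fun x => b x i) (Or.inl (hb i))).sub hs).div
        (derives_rowNormSq (Q := Q) (l := i) fun j => Or.inl (ho i j))).of_eq (fun x => rfl) ?_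
      omega
    have h2 : Derives (R' ∪ {fun x => stepCoeff (Q x) (b x) (partialSol (Q x) (b x) t) i})
        (⋃ j : Fin M, {fun x => partialSol (Q x) (b x) (t + 1) j}) (Fintype.card (Fin M) * 2) := by
      refine Derives.iUnion fun j => ?_
      refine ((Derives.of_mem (Or.inl (hp j))).add ((Derives.of_mem (Or.inr rfl)).mul
        (Derives.of_mem (f := fun x => orthoRow (Q x) i j) (Or.inl (Or.inl (ho i j)))))).of_eq
        (fun x => ?_) le_rfl
      rw [partialSol, dif_pos ht']
      rfl
    refine (((ih ht'.le).derive h1).derive h2).mono ?_ |>.mono_right ?_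
    · rintro f (hf | ⟨j, rfl⟩)
      · exact Or.inl (Or.inl (Or.inl hf))
      · refine Or.inr ?_
        simp only [Set.mem_iUnion, Set.mem_singleton_iff]
        exact ⟨j, rfl⟩
    · rw [Fintype.card_fin]
      nlinarith

end Solver

/-! ### The classical part of the algorithm -/

section ClassicalPart

variable {M : ℕ}

/-- The estimate of `⟨aⱼ|aₖ⟩ ‖aⱼ‖ ‖aₖ‖` as a function of the inputs. -/
def gramOfInput (x : PostInput M → ℂ) : Matrix (Fin M) (Fin M) ℂ := fun j k =>
  x (.norm j) * x (.norm k) * ((2 * x (.count j k false) / x .shots - 1)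
    + (2 * x (.count j k true) / x .shots - 1) * Complex.I)

/-- The matrix of the shifted system as a function of the inputs. -/
def shiftedOfInput (x : PostInput M → ℂ) : Matrix (Fin M) (Fin M) ℂ :=
  gramOfInput x ^ 2 + x .shift • 1

/-- The right-hand side of the shifted system as a function of the inputs. -/
def rhsOfInput (x : PostInput M → ℂ) : Fin M → ℂ := gramOfInput x *ᵥ fun j => x (.rhs j)

/-- The classical part runs in time `O(M³)`. -/
theorem exists_program (M : ℕ) : ∃ P : Program (PostInput M) (Fin M),
    ComputesCoefficients P ∧ (0 < M → P.steps ≤ 80 * M ^ 3) := by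
  set R₀ : Set ((PostInput M → ℂ) → ℂ) :=
    Set.range fun (i : PostInput M) (x : PostInput M → ℂ) => x i with hR₀
  have hin : ∀ i : PostInput M, Derives R₀ {fun x => x i} 0 :=
    fun i => Derives.of_mem ⟨i, rfl⟩
  set T₁ : Set ((PostInput M → ℂ) → ℂ) := ⋃ p : Fin M × Fin M, {fun x => gramOfInput x p.1 p.2}
    with hT₁
  have h1 : Derives R₀ T₁ (Fintype.card (Fin M × Fin M) * 19) := by
    refine Derives.iUnion fun p => ?_
    have hterm : ∀ im, Derives R₀ {fun x => 2 * x (.count p.1 p.2 im) / x .shots - 1} 7 := by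
      intro im
      exact ((((derives_one.add derives_one).mul (hin (.count p.1 p.2 im))).div
        (hin .shots)).sub derives_one).of_eq (fun x => by norm_num) le_rfl
    exact (((hin (.norm p.1)).mul (hin (.norm p.2))).mul
      ((hterm false).add ((hterm true).mul derives_I))).of_eq (fun x => rfl) le_rfl
  have r1 := reach_inputs.derive h1
  have m1 : ∀ j k, (fun x => gramOfInput x j k) ∈ R₀ ∪ T₁ := by
    intro j k
    refine Or.inr ?_
    simp only [hT₁, Set.mem_iUnion, Set.mem_singleton_iff]
    exact ⟨(j, k), rfl⟩
  set T₂ : Set ((PostInput M → ℂ) → ℂ) := ⋃ p : Fin M × Fin M, {fun x => shiftedOfInput x p.1 p.2}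
    with hT₂
  have h2 : Derives (R₀ ∪ T₁) T₂ (Fintype.card (Fin M × Fin M) * (2 * M + 7)) := by
    refine Derives.iUnion fun p => ?_
    have hs : Derives (R₀ ∪ T₁) {fun x => ∑ l, gramOfInput x p.1 l * gramOfInput x l p.2}
        (2 * M + 3) := by
      refine (Derives.sum Finset.univ fun l _ => (Derives.of_mem (m1 p.1 l)).mul
        (Derives.of_mem (m1 l p.2))).of_eq (fun x => rfl) ?_
      simp
      omega
    have hd : Derives (R₀ ∪ T₁) {fun x : PostInput M → ℂ => if p.1 = p.2 then x .shift else 0} 3 := by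
      by_cases h : p.1 = p.2
      · exact ((hin .shift).mono Set.subset_union_left subset_rfl le_rfl).of_eq
          (fun x => by rw [if_pos h]) (by norm_num)
      · exact derives_zero.of_eq (fun x => by rw [if_neg h]) le_rfl
    refine (hs.add hd).of_eq (fun x => ?_) (by omega)
    rw [shiftedOfInput, Matrix.add_apply, pow_two, Matrix.mul_apply, Matrix.smul_apply,
      Matrix.one_apply]
    simp
  have r2 := r1.derive h2
  set T₃ : Set ((PostInput M → ℂ) → ℂ) := ⋃ j : Fin M, {fun x => rhsOfInput x j} with hT₃
  have h3 : Derives (R₀ ∪ T₁ ∪ T₂) T₃ (Fintype.card (Fin M) * (2 * M + 3)) := by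
    refine Derives.iUnion fun j => ?_
    refine (Derives.sum Finset.univ fun l _ => (Derives.of_mem
      (f := fun x => gramOfInput x j l) (Or.inl (m1 j l))).mul
        (Derives.of_mem (f := fun x : PostInput M → ℂ => x (.rhs l)) (Or.inl (Or.inl ⟨.rhs l, rfl⟩)))).of_eq
          (fun x => rfl) ?_
    simp
    omega
  have r3 := r2.derive h3
  have mQ : ∀ i j, (fun x => shiftedOfInput x i j) ∈ R₀ ∪ T₁ ∪ T₂ ∪ T₃ := by
    intro i j
    refine Or.inl (Or.inr ?_)
    simp only [hT₂, Set.mem_iUnion, Set.mem_singleton_iff]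
    exact ⟨(i, j), rfl⟩
  have mb : ∀ i, (fun x => rhsOfInput x i) ∈ R₀ ∪ T₁ ∪ T₂ ∪ T₃ := by
    intro i
    refine Or.inr ?_
    simp only [hT₃, Set.mem_iUnion, Set.mem_singleton_iff]
    exact ⟨i, rfl⟩
  have r4 := reach_orthoRow r3 mQ M le_rfl
  have r5 := reach_partialSol r4 (fun i j => Or.inl (mQ i j)) (fun i => Or.inl (mb i))
    (fun i j => Or.inr ⟨i, i.2, j, rfl⟩) M le_rfl
  have r6 := r5.derive (Derives.iUnion (m := 1) (T := fun j : Fin M =>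
      {fun x : PostInput M → ℂ => partialSol (shiftedOfInput x) (rhsOfInput x) M j * x (.norm j)})
    fun j => by
      refine (Derives.of_mem ?_).mul (Derives.of_mem (f := fun x : PostInput M → ℂ => x (.norm j))
        (Or.inl (Or.inl (Or.inl (Or.inl (Or.inl ⟨.norm j, rfl⟩))))))
      exact Or.inr ⟨j, rfl⟩)
  obtain ⟨P, hP, hP'⟩ := r6.exists_program (F := fun j x =>
      partialSol (shiftedOfInput x) (rhsOfInput x) M j * x (.norm j)) fun j => by
    refine Or.inr ?_
    simp only [Set.mem_iUnion, Set.mem_singleton_iff]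
    exact ⟨j, rfl⟩
  refine ⟨P, ?_, fun hM => hP.trans ?_⟩
  · intro a c lam S z hu j
    rw [hP']
    have hQ : shiftedOfInput (postInput a c lam S z) = QHat a lam S z := rfl
    rw [hQ, partialSol_eq hu]
    rfl
  -- The total is 23M³ + 35M² + 12M + 3. For M ≥ 1 it is at most 73M³.
  · simp only [Fintype.card_prod, Fintype.card_fin]
    have e1 : M ≤ M ^ 3 := Nat.le_self_pow three_ne_zero M
    have e2 : M ^ 2 ≤ M ^ 3 := Nat.pow_le_pow_right hM (by norm_num)
    have e3 : 1 ≤ M ^ 3 := Nat.one_le_pow _ _ hM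
    nlinarith

end ClassicalPart

/-! ### Bounds on the parameters of the algorithm -/

section Parameters

variable {m : Type} [Fintype m] [DecidableEq m] {n M : ℕ}

lemma mainFactor_nonneg (A : Matrix m (Fin M) ℂ) (c : Fin M → ℂ) (ε : ℝ) :
    0 ≤ mainFactor A c ε := by
  have h : 0 ≤ cond A := mul_nonneg (norm_nonneg _) (norm_nonneg _)
  unfold mainFactor
  positivity

lemma gammaTwo_pos {U : Fin M → Circuit (Fin n)} {a : Fin M → ℝ} (hA : sysMatrix U a ≠ 0) :
    0 < gammaTwo a := by
  obtain ⟨j, hj⟩ : ∃ j, a j ≠ 0 := by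
    by_contra! h
    apply hA
    ext x j
    simp [sysMatrix, h j]
  exact (by positivity : 0 < a j ^ 2).trans_le (sq_le_gammaTwo a j)

lemma half_le_log {δ : ℝ} (hδ : 0 < δ) (hδ1 : δ < 1) :
    Real.log 2 ≤ Real.log (2 / δ) ∧ 1 / 2 ≤ Real.log (2 / δ) := by
  have h : Real.log 2 ≤ Real.log (2 / δ) := by
    apply Real.log_le_log (by norm_num)
    rw [le_div_iff₀ hδ]
    linarith
  exact ⟨h, by linarith [Real.log_two_gt_d9]⟩

/-- The square root is the level t in the concentration bound. With t² = 22M/T the exponent is at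
least 11M log(2/δ), of which 10M log(2/δ) pays for the 625^M pairs and the rest leaves δ/2. -/
lemma failure_probability {T S Γ δ : ℝ} (hM : 0 < M) (hT : 0 < T) (hΓ : 0 < Γ) (hδ : 0 < δ)
    (hδ1 : δ < 1) (hS : Γ ^ 2 * T * Real.log (2 / δ) ≤ S) :
    625 ^ M * Real.exp (-Real.sqrt (22 * M / T) ^ 2 / (2 * (Γ ^ 2 / S))) ≤ δ := by
  obtain ⟨hL2, hL⟩ := half_le_log hδ hδ1
  set L := Real.log (2 / δ) with hLdef
  have hM' : (1 : ℝ) ≤ M := by exact_mod_cast hM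
  have hS0 : 0 < S := lt_of_lt_of_le (by positivity) hS
  have h1 : 11 * M * L ≤ Real.sqrt (22 * M / T) ^ 2 / (2 * (Γ ^ 2 / S)) := by
    rw [Real.sq_sqrt (by positivity), le_div_iff₀ (by positivity)]
    have e : 11 * M * L * (2 * (Γ ^ 2 / S)) = 22 * M / T * (Γ ^ 2 * T * L / S) := by
      field_simp
      ring
    rw [e]
    exact mul_le_of_le_one_right (by positivity) ((div_le_one hS0).2 hS)
  have h2 : (625 : ℝ) ^ M ≤ Real.exp (10 * M * L) := by
    have e : (625 : ℝ) ≤ Real.exp (10 * L) := by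
      calc (625 : ℝ) ≤ 2 ^ 10 := by norm_num
        _ = Real.exp (Real.log 2) ^ 10 := by rw [Real.exp_log (by norm_num)]
        _ = Real.exp (10 * Real.log 2) := by rw [← Real.exp_nat_mul]; norm_num
        _ ≤ _ := Real.exp_le_exp.2 (by linarith)
    calc (625 : ℝ) ^ M ≤ Real.exp (10 * L) ^ M := by gcongr
      _ = Real.exp (10 * M * L) := by rw [← Real.exp_nat_mul]; congr 1; ring
  calc 625 ^ M * Real.exp (-Real.sqrt (22 * M / T) ^ 2 / (2 * (Γ ^ 2 / S)))
      ≤ Real.exp (10 * M * L) * Real.exp (-(11 * M * L)) := by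
        rw [neg_div]
        gcongr
    _ = Real.exp (-(M * L)) := by rw [← Real.exp_add]; congr 1; ring
    _ ≤ Real.exp (-L) := by
        apply Real.exp_le_exp.2
        nlinarith
    _ = δ / 2 := by
        rw [Real.exp_neg, hLdef, Real.exp_log (by positivity), inv_div]
    _ ≤ δ := by linarith

/-- The precision reached with `T` is sufficient. -/
lemma precision_bounds (A : Matrix m (Fin M) ℂ) (hA : A ≠ 0) (c : Fin M → ℂ) (ε : ℝ)
    (hM : 0 < M) :
    0 < sampleT (10 ^ 7) A c ε ∧
      4 * Real.sqrt (22 * M / sampleT (10 ^ 7) A c ε) ≤ 19 * specNorm A ^ 2 ∧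
      (4 * Real.sqrt (22 * M / sampleT (10 ^ 7) A c ε)) ^ 2 * mainFactor A c ε
        ≤ (1 / 168) ^ 2 := by
  have ha : 0 < specNorm A := by
    rw [specNorm_eq]
    exact norm_pos_iff.2 hA
  have hM' : (0 : ℝ) < M := by exact_mod_cast hM
  have hF := mainFactor_nonneg A c ε
  have hT1 : M / specNorm A ^ 4 ≤ sampleT (10 ^ 7) A c ε := by
    unfold sampleT
    have : 0 ≤ (10 : ℝ) ^ 7 * (M * mainFactor A c ε) := by positivity
    linarith
  have hT2 : 10 ^ 7 * (M * mainFactor A c ε) ≤ sampleT (10 ^ 7) A c ε := by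
    unfold sampleT
    have : 0 ≤ M / specNorm A ^ 4 := by positivity
    linarith
  have hT : 0 < sampleT (10 ^ 7) A c ε := lt_of_lt_of_le (by positivity) hT1
  set T := sampleT (10 ^ 7) A c ε
  have hsq : (4 * Real.sqrt (22 * M / T)) ^ 2 = 352 * M / T := by
    rw [mul_pow, Real.sq_sqrt (by positivity)]
    ring
  refine ⟨hT, ?_, ?_⟩
  -- Here the summand M/‖A‖⁴ of T is used: η² = 352M/T ≤ 352‖A‖⁴, and 352 ≤ 19².
  · apply abs_le_of_sq_le_sq' _ (by positivity) |>.2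
    rw [hsq, div_le_iff₀ hT]
    rw [div_le_iff₀ (by positivity)] at hT1
    nlinarith
  -- Here the main summand of T is used: 352/10⁷ lies just below 1/168², which fixes C = 10⁷.
  · rw [hsq, div_mul_eq_mul_div, div_le_iff₀ hT]
    nlinarith

lemma rate_nonneg (A : Matrix m (Fin M) ℂ) (a : Fin M → ℝ) (c : Fin M → ℂ) (ε : ℝ) :
    0 ≤ rate A a c ε := by
  have ha : 0 ≤ specNorm A := norm_nonneg _
  have hF := mainFactor_nonneg A c ε
  unfold rate
  positivity

/-- Apart from the constant, M²Γ₂²T is the rate; rounding S up costs at most one run per test, which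
is the summand M². -/
lemma shots_mul_sq_le (A : Matrix m (Fin M) ℂ) (a : Fin M → ℝ) (c : Fin M → ℂ) (ε : ℝ) {δ : ℝ}
    (hδ : 0 < δ) (hδ1 : δ < 1) :
    (M : ℝ) ^ 2 * shots (10 ^ 7) A a c ε δ
      ≤ 10 ^ 7 * (Real.log (2 / δ) * rate A a c ε) + M ^ 2 := by
  have ha : 0 ≤ specNorm A := norm_nonneg _
  have hF := mainFactor_nonneg A c ε
  obtain ⟨-, hL⟩ := half_le_log hδ hδ1
  have hT : 0 ≤ sampleT (10 ^ 7) A c ε := by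
    unfold sampleT
    positivity
  have h1 : (shots (10 ^ 7) A a c ε δ : ℝ)
      ≤ gammaTwo a ^ 2 * sampleT (10 ^ 7) A c ε * Real.log (2 / δ) + 1 :=
    (Nat.ceil_lt_add_one (by positivity)).le
  have h2 : (M : ℝ) ^ 2 * (gammaTwo a ^ 2 * sampleT (10 ^ 7) A c ε * Real.log (2 / δ))
      ≤ 10 ^ 7 * (Real.log (2 / δ) * rate A a c ε) := by
    have e : 10 ^ 7 * (Real.log (2 / δ) * rate A a c ε)
        - (M : ℝ) ^ 2 * (gammaTwo a ^ 2 * sampleT (10 ^ 7) A c ε * Real.log (2 / δ))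
        = (10 ^ 7 - 1) * (Real.log (2 / δ) * (gammaTwo a ^ 2 * M ^ 3 / specNorm A ^ 4)) := by
      unfold rate sampleT
      ring
    have : 0 ≤ (10 ^ 7 - 1)
        * (Real.log (2 / δ) * (gammaTwo a ^ 2 * M ^ 3 / specNorm A ^ 4)) := by
      have : (0 : ℝ) ≤ 10 ^ 7 - 1 := by norm_num
      positivity
    linarith
  nlinarith [sq_nonneg (M : ℝ)]

lemma l2norm_state (C : Circuit (Fin n)) : l2norm C.state = 1 := by
  have h : l2norm C.state ^ 2 = 1 := by
    rw [l2norm_sq]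
    exact sum_norm_sq_column C.toMatrix_mem _
  exact (pow_eq_one_iff_of_nonneg (l2norm_nonneg _) two_ne_zero).1 h

lemma l2norm_single {ι : Type} [Fintype ι] [DecidableEq ι] (j : ι) :
    l2norm (Pi.single j (1 : ℂ)) = 1 := by
  have h : l2norm (Pi.single j (1 : ℂ)) ^ 2 = 1 := by
    rw [l2norm_sq, Finset.sum_eq_single j]
    · simp
    · intro i _ hi
      simp [hi]
    · simp
  exact (pow_eq_one_iff_of_nonneg (l2norm_nonneg _) two_ne_zero).1 h

lemma sysMatrix_mulVec (U : Fin M → Circuit (Fin n)) (a : Fin M → ℝ) (α : Fin M → ℂ) :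
    sysMatrix U a *ᵥ α = ∑ j, (α j * (a j : ℂ)) • (U j).state := by
  funext x
  rw [Finset.sum_apply, mulVec, dotProduct]
  refine Finset.sum_congr rfl fun j _ => ?_
  rw [sysMatrix, Pi.smul_apply, smul_eq_mul]
  ring

/-- With independent columns A⁺A = 1, so a unit vector e_j gives 1 = ‖A⁺Ae_j‖ ≤ ‖A⁺‖‖a_j‖. A single
column suffices. -/
lemma one_le_norm_pinv_mul_gammaTwo {U : Fin M → Circuit (Fin n)} {a : Fin M → ℝ}
    (ha : ∀ j, 0 ≤ a j) (hM : 0 < M) (h : LinearIndependent ℂ (sysMatrix U a)ᵀ) :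
    1 ≤ ‖pinv (sysMatrix U a)‖ ^ 4 * gammaTwo a ^ 2 := by
  set A := sysMatrix U a with hA
  set j : Fin M := ⟨0, hM⟩
  have h1 : l2norm (A *ᵥ Pi.single j 1) = a j := by
    rw [hA, sysMatrix_mulVec, Finset.sum_eq_single j]
    · rw [l2norm_smul, l2norm_state]
      simp [abs_of_nonneg (ha j)]
    · intro i _ hi
      simp [hi]
    · simp
  have h2 : 1 ≤ ‖pinv A‖ * a j := by
    have h3 := l2norm_mulVec_le (pinv A) (A *ᵥ Pi.single j 1)
    rwa [mulVec_mulVec, pinv_mul_self_of_linearIndependent A h, one_mulVec, h1,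
      l2norm_single] at h3
  calc (1 : ℝ) ≤ (‖pinv A‖ * a j) ^ 4 := one_le_pow₀ h2
    _ = ‖pinv A‖ ^ 4 * (a j ^ 2) ^ 2 := by ring
    _ ≤ _ := by
        gcongr
        exact sq_le_gammaTwo a j

/-- From κ ≥ 1, ‖c‖ ≥ ε and a bracket of at least ε it follows that F ≥ ‖A⁺‖⁴, and Γ₂²‖A⁺‖⁴ ≥ 1.
This absorbs the rounding of S and the classical part into R. -/
lemma cube_le_rate {U : Fin M → Circuit (Fin n)} {a : Fin M → ℝ} {c : Fin M → ℂ} {ε : ℝ}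
    (ha : ∀ j, 0 ≤ a j) (hA : sysMatrix U a ≠ 0) (hε : 0 < ε) (hM : 0 < M)
    (h : LinearIndependent ℂ (sysMatrix U a)ᵀ) (hc : ε ≤ l2norm c) :
    (M : ℝ) ^ 3 ≤ rate (sysMatrix U a) a c ε := by
  have h1 := one_le_norm_pinv_mul_gammaTwo ha hM h
  set A := sysMatrix U a with hAdef
  have hκ : 1 ≤ cond A := one_le_norm_mul_norm_pinv A hA
  have hs : ε ≤ specNorm A ^ 2 * l2norm (alphaStar A c) + ε + l2norm c := by
    have := l2norm_nonneg (alphaStar A c)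
    have : 0 ≤ specNorm A ^ 2 * l2norm (alphaStar A c) := by positivity
    linarith
  set s := specNorm A ^ 2 * l2norm (alphaStar A c) + ε + l2norm c with hsdef
  have hF : ‖pinv A‖ ^ 4 ≤ mainFactor A c ε := by
    unfold mainFactor
    rw [← hsdef, le_div_iff₀ (by positivity), specNorm_eq]
    calc ‖pinv A‖ ^ 4 * ε ^ 4 = 1 * ‖pinv A‖ ^ 4 * ε ^ 2 * ε ^ 2 := by ring
      _ ≤ cond A ^ 12 * ‖pinv A‖ ^ 4 * l2norm c ^ 2 * s ^ 2 := by
          have := one_le_pow₀ hκ (n := 12)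
          gcongr
  have h2 : 0 ≤ gammaTwo a ^ 2 * M ^ 3 / specNorm A ^ 4 := by
    have : 0 ≤ specNorm A := norm_nonneg _
    positivity
  unfold rate
  calc (M : ℝ) ^ 3 = 1 * M ^ 3 := by ring
    _ ≤ (‖pinv A‖ ^ 4 * gammaTwo a ^ 2) * M ^ 3 := by gcongr
    _ = gammaTwo a ^ 2 * M ^ 3 * ‖pinv A‖ ^ 4 := by ring
    _ ≤ gammaTwo a ^ 2 * M ^ 3 * mainFactor A c ε := by gcongr
    _ ≤ _ := by linarith

lemma runTime_le (test : Fin M → Fin M → Bool → Circuit (Option (Fin n))) (S D : ℕ)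
    (P : Program (PostInput M) (Fin M)) (htest : ∀ j k im, (test j k im).depth + 1 ≤ D) :
    runTime test S P ≤ M ^ 2 * S * (2 * D) + P.steps := by
  unfold runTime
  gcongr
  calc ∑ j, ∑ k, ∑ im, S * ((test j k im).depth + 1)
      ≤ ∑ _j : Fin M, ∑ _k : Fin M, ∑ _im : Bool, S * D := by
        gcongr
        exact htest _ _ _
    _ = M ^ 2 * S * (2 * D) := by
        simp
        ring

end Parameters

/-- The estimate of `A† A` is accurate with high probability, and then the algorithm succeeds. -/
lemma success_probability {n M : ℕ} (hM : 0 < M) {P : Program (PostInput M) (Fin M)}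
    (hP : ComputesCoefficients P) {U : Fin M → Circuit (Fin n)} {a : Fin M → ℝ} {c : Fin M → ℂ}
    {ε δ : ℝ} (hA : sysMatrix U a ≠ 0) (hc : c ≠ 0) (hε : 0 < ε) (hδ : 0 < δ) (hδ1 : δ < 1)
    {test : Fin M → Fin M → Bool → Circuit (Option (Fin n))}
    (htest : ∀ j k im, IsHadamardTest (test j k im) im ((U j).toMatrixᴴ * (U k).toMatrix))
    {S : ℕ} (hS : S = shots (10 ^ 7) (sysMatrix U a) a c ε δ) :
    1 - δ ≤ (recordLaw test S).real
      {ω | IsUnit (QHat a (shift (sysMatrix U a) c ε) S (zeroCount ω)).det ∧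
        IsApproxSolution (sysMatrix U a) c ε
          (∑ j, P.eval (postInput a c (shift (sysMatrix U a) c ε) S (zeroCount ω)) j
            • (U j).state)} := by
  have hΓ := gammaTwo_pos hA
  obtain ⟨-, hL⟩ := half_le_log hδ hδ1
  obtain ⟨hT, hη1, hη2⟩ := precision_bounds (sysMatrix U a) hA c ε hM
  have hM' : (0 : ℝ) < M := by exact_mod_cast hM
  have hSle : gammaTwo a ^ 2 * sampleT (10 ^ 7) (sysMatrix U a) c ε * Real.log (2 / δ) ≤ S := by
    rw [hS]
    exact Nat.le_ceil _
  have hS0 : 0 < S := by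
    have : (0 : ℝ) < S := lt_of_lt_of_le (by positivity) hSle
    exact_mod_cast this
  have hfail := failure_probability hM hT hΓ hδ hδ1 hSle
  set t := Real.sqrt (22 * M / sampleT (10 ^ 7) (sysMatrix U a) c ε) with ht
  have ht0 : 0 < t := Real.sqrt_pos.2 (by positivity)
  have hconc := estimate_concentration hS0 a U test htest ht0
  refine le_trans (by linarith) (hconc.trans ?_)
  have hprob : MeasureTheory.IsProbabilityMeasure (recordLaw test S) := by
    have : ∀ i : Fin M × Fin M × Bool × Fin S, MeasureTheory.IsProbabilityMeasure
        ((test i.1 i.2.1 i.2.2.1).outcomeLaw none) := fun i =>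
      isProbabilityMeasure_outcomeLaw
        (mul_mem (Unitary.star_mem (U i.1).toMatrix_mem) (U i.2.1).toMatrix_mem) (htest _ _ _)
    unfold recordLaw
    infer_instance
  refine MeasureTheory.measureReal_mono ?_ (MeasureTheory.measure_ne_top _ _)
  intro ω hω
  obtain ⟨h1, h2⟩ := approximate_solution (sysMatrix U a) hA c hc hε (by positivity)
    (VHat a S (zeroCount ω)) hω hη1 hη2
  refine ⟨h1, ?_⟩
  have h3 : ∀ j, P.eval (postInput a c (shift (sysMatrix U a) c ε) S (zeroCount ω)) j
      = alphaHat a c (shift (sysMatrix U a) c ε) S (zeroCount ω) j * (a j : ℂ) := hP _ _ _ _ _ h1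
  simp only [h3]
  rw [← sysMatrix_mulVec]
  exact h2

end SkewedLS

end

/-! ### Assembly: the universal constants and the running time. -/

theorem mainTheorem2 :
    ∃ C K : ℝ, 0 < C ∧ 0 < K ∧
      ∀ M : ℕ, ∃ P : SkewedLS.Program (SkewedLS.PostInput M) (Fin M),
        SkewedLS.ComputesCoefficients P ∧
        ∀ (n d : ℕ) (U : Fin M → SkewedLS.Circuit (Fin n)) (a : Fin M → ℝ) (c : Fin M → ℂ)
          (ε δ : ℝ),
          (∀ j, (U j).depth ≤ d) → (∀ j, 0 ≤ a j) → SkewedLS.sysMatrix U a ≠ 0 → c ≠ 0 →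
          0 < ε → 0 < δ → δ < 1 →
          ∃ test : Fin M → Fin M → Bool → SkewedLS.Circuit (Option (Fin n)),
            (∀ j k im, SkewedLS.IsHadamardTest (test j k im) im
              ((U j).toMatrix.conjTranspose * (U k).toMatrix)) ∧
            (1 - δ ≤ (SkewedLS.recordLaw test
                (SkewedLS.shots C (SkewedLS.sysMatrix U a) a c ε δ)).real
              {ω | IsUnit (SkewedLS.QHat a (SkewedLS.shift (SkewedLS.sysMatrix U a) c ε)
                    (SkewedLS.shots C (SkewedLS.sysMatrix U a) a c ε δ)
                    (SkewedLS.zeroCount ω)).det ∧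
                  SkewedLS.IsApproxSolution (SkewedLS.sysMatrix U a) c ε
                    (∑ j, P.eval (SkewedLS.postInput a c
                        (SkewedLS.shift (SkewedLS.sysMatrix U a) c ε)
                        (SkewedLS.shots C (SkewedLS.sysMatrix U a) a c ε δ)
                        (SkewedLS.zeroCount ω)) j • (U j).state)}) ∧
            ((SkewedLS.runTime test (SkewedLS.shots C (SkewedLS.sysMatrix U a) a c ε δ) P : ℝ) ≤
              K * ((n + 1) * (d + 1) *
                  (Real.log (2 / δ) * SkewedLS.rate (SkewedLS.sysMatrix U a) a c ε + M ^ 2)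
                + M ^ 3)) ∧
            (LinearIndependent ℂ (SkewedLS.sysMatrix U a).transpose → ε ≤ SkewedLS.l2norm c →
              (SkewedLS.runTime test (SkewedLS.shots C (SkewedLS.sysMatrix U a) a c ε δ) P : ℝ) ≤
                K * ((n + 1) * (d + 1) * Real.log (2 / δ) *
                  SkewedLS.rate (SkewedLS.sysMatrix U a) a c ε)) := by
  refine ⟨10 ^ 7, 10 ^ 9, by norm_num, by norm_num, fun M => ?_⟩
  obtain ⟨P, hP, hsteps⟩ := SkewedLS.exists_program M
  refine ⟨P, hP, fun n d U a c ε δ hd ha hA hc hε hδ hδ1 => ?_⟩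
  have hM : 0 < M := by
    rcases Nat.eq_zero_or_pos M with rfl | h
    · exact absurd (Subsingleton.elim c 0) hc
    · exact h
  have hex : ∀ j k im, ∃ T : SkewedLS.Circuit (Option (Fin n)),
      SkewedLS.IsHadamardTest T im ((U j).toMatrix.conjTranspose * (U k).toMatrix) ∧
        T.depth ≤ 14 * ((n + 1) * (d + 1)) := by
    intro j k im
    simpa using SkewedLS.exists_hadamardTest (U j) (U k) (hd j) (hd k) im
  choose test htest hdepth using hex
  obtain ⟨-, hL⟩ := SkewedLS.half_le_log hδ hδ1
  have hS := SkewedLS.shots_mul_sq_le (SkewedLS.sysMatrix U a) a c ε hδ hδ1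
  have hR := SkewedLS.rate_nonneg (SkewedLS.sysMatrix U a) a c ε
  have hrun : (SkewedLS.runTime test
      (SkewedLS.shots (10 ^ 7) (SkewedLS.sysMatrix U a) a c ε δ) P : ℝ) ≤
      30 * ((n + 1) * (d + 1)) * (10 ^ 7 * (Real.log (2 / δ) *
        SkewedLS.rate (SkewedLS.sysMatrix U a) a c ε) + M ^ 2) + 80 * M ^ 3 := by
    -- The factor 15 is the 14 of the circuit depth plus the unit for the measurement; the two parts
    -- of each inner product make it 30.
    have h1 := SkewedLS.runTime_le test
      (SkewedLS.shots (10 ^ 7) (SkewedLS.sysMatrix U a) a c ε δ) (15 * ((n + 1) * (d + 1))) P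
      (fun j k im => by
        have := hdepth j k im
        have : 1 ≤ (n + 1) * (d + 1) := Nat.mul_pos n.succ_pos d.succ_pos
        omega)
    have h2 := h1.trans (Nat.add_le_add_left (hsteps hM) _)
    have h3 : (SkewedLS.runTime test
        (SkewedLS.shots (10 ^ 7) (SkewedLS.sysMatrix U a) a c ε δ) P : ℝ) ≤
        (M : ℝ) ^ 2 * SkewedLS.shots (10 ^ 7) (SkewedLS.sysMatrix U a) a c ε δ
          * (2 * (15 * ((n + 1) * (d + 1)))) + 80 * M ^ 3 := by exact_mod_cast h2
    refine h3.trans ?_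
    have h4 : (0 : ℝ) ≤ 2 * (15 * ((n + 1) * (d + 1))) := by positivity
    have h5 := mul_le_mul_of_nonneg_right hS h4
    linarith
  have hD : (1 : ℝ) ≤ (n + 1) * (d + 1) := by
    have : 1 ≤ (n + 1) * (d + 1) := Nat.mul_pos n.succ_pos d.succ_pos
    exact_mod_cast this
  have hM' : (1 : ℝ) ≤ M := by exact_mod_cast hM
  set D : ℝ := (n + 1) * (d + 1) with hDdef
  set L := Real.log (2 / δ) with hLdef
  set R := SkewedLS.rate (SkewedLS.sysMatrix U a) a c ε with hRdef
  have hLR : 0 ≤ L * R := mul_nonneg (by linarith) hR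
  have hDLR : 0 ≤ D * (L * R) := mul_nonneg (by linarith) hLR
  refine ⟨test, htest, SkewedLS.success_probability hM hP hA hc hε hδ hδ1 htest rfl, ?_, ?_⟩
  · refine hrun.trans ?_
    have h1 : 0 ≤ D * (M : ℝ) ^ 2 := by positivity
    have h2 : 0 ≤ (M : ℝ) ^ 3 := by positivity
    nlinarith
  · intro hlin hεc
    have hcube := SkewedLS.cube_le_rate ha hA hε hM hlin hεc
    rw [← hRdef] at hcube
    -- Since log(2/δ) ≥ 1/2, terms without the logarithm are dominated by those with it; then M² ≤
    -- M³ ≤ R ≤ 2LR.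
    have h1 : R ≤ 2 * (L * R) := by nlinarith
    have h2 : (M : ℝ) ^ 2 ≤ M ^ 3 := pow_le_pow_right₀ hM' (by norm_num)
    have h3 : D * (M : ℝ) ^ 2 ≤ D * (2 * (L * R)) :=
      mul_le_mul_of_nonneg_left (by linarith) (by linarith)
    have h4 : L * R ≤ D * (L * R) := le_mul_of_one_le_left hLR hD
    refine hrun.trans ?_
    nlinarith
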